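/- Let $n,m\ge 1$, let $f\in\mathbb C[z_0,\dots,z_n]$ be homogeneous of degree $m$, and let $X=\{f=0\}\subset\mathbb C^{n+1}$, where $df\neq 0$ at every point of $X\setminus\{0\}$ (so $X$ has at most an isolated singularity at $0$). Let $\rho=\log(1+\sum_j|z_j|^2)$, $a>0$ and $\mathcal U=X\cap\{\rho<a\}$. Let $\pi:Y\to X$ be the restriction to the strict transform $Y=\{(z,[l])\in \mathrm{Bl}_0\mathbb C^{n+1}: f(l)=0\}$ of the blow-up of the origin of $\mathbb C^{n+1}$; $Y$ is a complex manifold of dimension $n$ with smooth exceptional divisor $E'=\{z=0\}\subset Y$, and we write $\rho$ also for $\rho\circ\pi$. Fix the following data. - A smooth Kähler form $\theta$ on $Y$. - A generator $\nu$ of the canonical bundle of $X$ over an open neighbourhood $V$ of $\overline{\mathcal U}$, that is, a nowhere vanishing holomorphic $n$-form on $(X\cap V)\setminus\{0\}$; let $d\in\mathbb Z$ be such that $K_Y=\pi^*K_X+dE'$, i.e. $\pi^*\nu$ has divisor $dE'$. Put $\Omega_X=(\sqrt{-1})^{n^2}\nu\wedge\bar\nu$, $E=\max(d,0)E'$, $F=\max(-d,0)E'$.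 - Smooth hermitian metrics $h_E,h_F$ on the line bundles of $E,F$, with defining sections $\sigma_E,\sigma_F$. Let $\Omega_Y=(|\sigma_E|^2_{h_E})^{-1}|\sigma_F|^2_{h_F}\,\Omega_X$, extended across $E'$ to a smooth strictly positive volume form. - A smooth function $\psi_1$ on $Y$ vanishing in a neighbourhood of $E'$, and $A_0\in\mathbb R$ such that $\omega:=A_0\sqrt{-1}\,\partial\bar\partial(\rho-a)+\sqrt{-1}\,\partial\bar\partial\psi_1$ is semipositive on $\pi^{-1}(\mathcal U)$. Then for every $s>0$ there is $A_1\in\mathbb R$ such that for every $A\ge A_1$ the function $\Phi=A(\rho-a)$ is a smooth subsolution with zero boundary values of the perturbed Monge–Ampère equation $(\omega+s\theta+\sqrt{-1}\,\partial\bar\partial\varphi)^n=(|\sigma_E|^2_{h_E}+s)(|\sigma_F|^2_{h_F}+s)^{-1}\Omega_Y$; that is, $\Phi$ is smooth, $\Phi=0$ on $\pi^{-1}(\partial\mathcal U)$ (with $\partial\mathcal U=\overline{\mathcal U}\setminus\mathcal U$), and on $\pi^{-1}(\mathcal U)$ $$\omega+s\theta+\sqrt{-1}\,\partial\bar\partial\Phi>0,\qquad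 (\omega+s\theta+\sqrt{-1}\,\partial\bar\partial\Phi)^n\ \ge\ (|\sigma_E|^2_{h_E}+s)(|\sigma_F|^2_{h_F}+s)^{-1}\,\Omega_Y .$$ -/

import Mathlib

open scoped ContDiff ComplexOrder

noncomputable section

namespace BlowupMA

/-! ### The cone `X = {f = 0}` and the domain `U` -/

/-- The potential `ρ(z) = log (1 + ∑ |z_j|²)` on `ℂ^{n+1}`. -/
def rho {n : ℕ} (z : Fin (n + 1) → ℂ) : ℝ := Real.log (1 + ∑ j, ‖z j‖ ^ 2)

/-- The hypersurface `{f = 0}` has no singular point other than the origin. -/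
def SmoothAwayFromOrigin {n : ℕ} (f : MvPolynomial (Fin (n + 1)) ℂ) : Prop :=
  ∀ z : Fin (n + 1) → ℂ, z ≠ 0 → MvPolynomial.eval z f = 0 →
    ∃ i, MvPolynomial.eval z (MvPolynomial.pderiv i f) ≠ 0

/-- The domain `U = X ∩ {ρ < a}`. -/
def domain {n : ℕ} (f : MvPolynomial (Fin (n + 1)) ℂ) (a : ℝ) : Set (Fin (n + 1) → ℂ) :=
  {z | MvPolynomial.eval z f = 0 ∧ rho z < a}

/-! ### The blow-up of the origin and the strict transform `Y` of `X` -/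

/-- The blow-up of the origin of `ℂ^{n+1}`, inside `ℂ^{n+1} × ℙ^n`. -/
def blowupOrigin (n : ℕ) :
    Set ((Fin (n + 1) → ℂ) × Projectivization ℂ (Fin (n + 1) → ℂ)) :=
  {y | ∀ i j, y.1 i * y.2.rep j = y.1 j * y.2.rep i}

/-- The strict transform `Y` of the cone `{f = 0}`, for `f` homogeneous: the pairs `(z, [l])` of the
blow-up with `f(l) = 0`.  The map `π : Y → X` is the first projection, and the exceptional divisor
`E' = {z = 0}` is the projective hypersurface `{f = 0}`. -/
def strictTransform {n : ℕ} (f : MvPolynomial (Fin (n + 1)) ℂ) :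
    Set ((Fin (n + 1) → ℂ) × Projectivization ℂ (Fin (n + 1) → ℂ)) :=
  {y | y ∈ blowupOrigin n ∧ MvPolynomial.eval y.2.rep f = 0}

/-- The vector `l` with `l_i = 1` and remaining entries `v`. -/
def homog {n : ℕ} (i : Fin (n + 1)) (v : Fin n → ℂ) : Fin (n + 1) → ℂ :=
  Fin.insertNth (α := fun _ => ℂ) i 1 v

theorem homog_same {n : ℕ} (i : Fin (n + 1)) (v : Fin n → ℂ) : homog i v i = 1 := by
  simp [homog]

theorem homog_ne_zero {n : ℕ} (i : Fin (n + 1)) (v : Fin n → ℂ) : homog i v ≠ 0 := by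
  intro h
  have h1 := congrFun h i
  rw [homog_same] at h1
  exact one_ne_zero h1

/-- The inverse of the standard affine coordinates `(z_i, (l_j / l_i)_{j ≠ i})` on the part
`{l_i ≠ 0}` of the blow-up.  In these coordinates `E'` is `{z_i = 0}`. -/
def affinePoint {n : ℕ} (i : Fin (n + 1)) (p : ℂ × (Fin n → ℂ)) :
    (Fin (n + 1) → ℂ) × Projectivization ℂ (Fin (n + 1) → ℂ) :=
  (p.1 • homog i p.2, Projectivization.mk ℂ (homog i p.2) (homog_ne_zero i p.2))

/-- A local holomorphic coordinate system on the `n`-dimensional complex manifold `Y`, presented by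
its inverse: an injective holomorphic immersion of an open subset of `ℂ^n` into `Y`, with image in
one of the standard affine pieces `{l_i ≠ 0}` of the blow-up. -/
structure LocalChart {n : ℕ} (f : MvPolynomial (Fin (n + 1)) ℂ) where
  idx : Fin (n + 1)
  source : Set (Fin n → ℂ)
  isOpen_source : IsOpen source
  coord : (Fin n → ℂ) → ℂ × (Fin n → ℂ)
  holomorphic : AnalyticOnNhd ℂ coord source
  injective : Set.InjOn coord source
  immersion : ∀ w ∈ source, Function.Injective (fderiv ℂ coord w)
  mem : ∀ w ∈ source, affinePoint idx (coord w) ∈ strictTransform f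

namespace LocalChart

variable {n : ℕ} {f : MvPolynomial (Fin (n + 1)) ℂ}

/-- The point of `Y` with coordinates `w`. -/
def pt (c : LocalChart f) (w : Fin n → ℂ) :
    (Fin (n + 1) → ℂ) × Projectivization ℂ (Fin (n + 1) → ℂ) :=
  affinePoint c.idx (c.coord w)

/-- The local equation `t = z_i` of the exceptional divisor. -/
def t (c : LocalChart f) (w : Fin n → ℂ) : ℂ := (c.coord w).1

/-- The homogeneous coordinates `l` of the point of `ℙ^n` below, normalized by `l_i = 1`. -/
def l (c : LocalChart f) (w : Fin n → ℂ) : Fin (n + 1) → ℂ := homog c.idx (c.coord w).2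

end LocalChart

/-- `φ` is the (germ at `w` of the) change of coordinates from `c` to `c'`. -/
structure IsTransition {n : ℕ} {f : MvPolynomial (Fin (n + 1)) ℂ} (c c' : LocalChart f)
    (φ : (Fin n → ℂ) → (Fin n → ℂ)) (w : Fin n → ℂ) : Prop where
  mem_source : w ∈ c.source
  map_mem_source : φ w ∈ c'.source
  differentiableAt : DifferentiableAt ℂ φ w
  pt_eq : ∀ᶠ v in nhds w, c.pt v = c'.pt (φ v)

/-- The complex Jacobian matrix `(∂φ_p / ∂w_j)_{p j}`. -/
def jacobian {n : ℕ} (φ : (Fin n → ℂ) → (Fin n → ℂ)) (w : Fin n → ℂ) :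
    Matrix (Fin n) (Fin n) ℂ :=
  Matrix.of fun p j => fderiv ℂ φ w (Pi.single j 1) p

/-! ### Smooth functions and `(1,1)`-forms on `Y` -/

/-- Smooth real functions on `Y` (the values off `Y` are irrelevant). -/
def IsSmooth {n : ℕ} (f : MvPolynomial (Fin (n + 1)) ℂ)
    (u : (Fin (n + 1) → ℂ) × Projectivization ℂ (Fin (n + 1) → ℂ) → ℝ) : Prop :=
  ∀ c : LocalChart f, ContDiffOn ℝ ∞ (fun w => u (c.pt w)) c.source

/-- The Wirtinger derivative `∂/∂w_j = (∂/∂x_j - √-1 ∂/∂y_j) / 2`. -/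
def dWirt {n : ℕ} (j : Fin n) (g : (Fin n → ℂ) → ℂ) (w : Fin n → ℂ) : ℂ :=
  (1 / 2) * (fderiv ℝ g w (Pi.single j 1) - Complex.I * fderiv ℝ g w (Pi.single j Complex.I))

/-- The Wirtinger derivative `∂/∂w̄_j = (∂/∂x_j + √-1 ∂/∂y_j) / 2`. -/
def dbarWirt {n : ℕ} (j : Fin n) (g : (Fin n → ℂ) → ℂ) (w : Fin n → ℂ) : ℂ :=
  (1 / 2) * (fderiv ℝ g w (Pi.single j 1) + Complex.I * fderiv ℝ g w (Pi.single j Complex.I))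

/-- The coefficient matrices, in the local coordinates of `Y`, of a family of `(1,1)`-forms
`√-1 ∑ G_{jk} dw_j ∧ dw̄_k`. -/
abbrev Coeff {n : ℕ} (f : MvPolynomial (Fin (n + 1)) ℂ) : Type :=
  LocalChart f → (Fin n → ℂ) → Matrix (Fin n) (Fin n) ℂ

/-- The coefficient matrices `(∂²u / ∂w_j ∂w̄_k)` of `√-1 ∂∂̄ u`. -/
def ddbar {n : ℕ} (f : MvPolynomial (Fin (n + 1)) ℂ)
    (u : (Fin (n + 1) → ℂ) × Projectivization ℂ (Fin (n + 1) → ℂ) → ℝ) : Coeff f :=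
  fun c w => Matrix.of fun j k => dWirt j (dbarWirt k fun v => (u (c.pt v) : ℂ)) w

/-- A smooth `(1,1)`-form on `Y`, given by its coefficient matrices in all local coordinates. -/
structure Form11 {n : ℕ} (f : MvPolynomial (Fin (n + 1)) ℂ) where
  coeff : Coeff f
  smooth : ∀ c j k, ContDiffOn ℝ ∞ (fun w => coeff c w j k) c.source
  transform : ∀ c c' φ w, IsTransition c c' φ w →
    coeff c w = (jacobian φ w).transpose * coeff c' (φ w) * (jacobian φ w).map star

/-- A Kähler form: positive definite and closed. -/
structure Form11.IsKahler {n : ℕ} {f : MvPolynomial (Fin (n + 1)) ℂ} (θ : Form11 f) : Prop where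
  posDef : ∀ (c : LocalChart f), ∀ w ∈ c.source, (θ.coeff c w).PosDef
  closed : ∀ (c : LocalChart f), ∀ w ∈ c.source, ∀ i j k,
    dWirt i (fun v => θ.coeff c v j k) w = dWirt j (fun v => θ.coeff c v i k) w

/-- The form `ω = A₀ √-1 ∂∂̄ (ρ - a) + √-1 ∂∂̄ ψ₁`. -/
def omega {n : ℕ} (f : MvPolynomial (Fin (n + 1)) ℂ) (a A₀ : ℝ)
    (ψ₁ : (Fin (n + 1) → ℂ) × Projectivization ℂ (Fin (n + 1) → ℂ) → ℝ) : Coeff f :=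
  fun c w => (A₀ : ℂ) • ddbar f (fun y => rho y.1 - a) c w + ddbar f ψ₁ c w

/-! ### Volume forms

A volume form on `Y` is written `V · ∏_j (√-1 dw_j ∧ dw̄_j)` in local coordinates, and is given by
its coefficients `V`. -/

/-- The coefficient of `β^n`, for `β = √-1 ∑ G_{jk} dw_j ∧ dw̄_k`. -/
def topPower {n : ℕ} (G : Matrix (Fin n) (Fin n) ℂ) : ℝ := (n.factorial : ℝ) * G.det.re

/-- A smooth hermitian metric on the line bundle `O(k E')`.  In local coordinates that bundle is
trivialized so that the defining section is `t^k`, and the metric is given by its weight; the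
transition functions are powers of `t_{c'} / t_c`, which is the entry `c'.idx` of `c.l`. -/
structure HermitianMetric {n : ℕ} (f : MvPolynomial (Fin (n + 1)) ℂ) (k : ℕ) where
  weight : LocalChart f → (Fin n → ℂ) → ℝ
  smooth : ∀ c, ContDiffOn ℝ ∞ (weight c) c.source
  pos : ∀ c, ∀ w ∈ c.source, 0 < weight c w
  transform : ∀ c c', ∀ w ∈ c.source, ∀ w' ∈ c'.source, c.pt w = c'.pt w' →
    weight c w = ‖c.l w c'.idx‖ ^ (2 * k) * weight c' w'

/-- The squared norm `|σ|²_h` of the defining section `σ` of `k E'`. -/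
def HermitianMetric.normSq {n : ℕ} {f : MvPolynomial (Fin (n + 1)) ℂ} {k : ℕ}
    (h : HermitianMetric f k) (c : LocalChart f) (w : Fin n → ℂ) : ℝ :=
  ‖c.t w‖ ^ (2 * k) * h.weight c w

/-- A generator `ν` of the canonical bundle of `X` over the open set `V` (a nowhere vanishing
holomorphic `n`-form on `(X ∩ V) \ {0}`), where `K_Y = π^* K_X + d E'` over `V`: in local
coordinates `π^* ν = t^d g dw_1 ∧ ⋯ ∧ dw_n` with `g` holomorphic and nowhere zero, also along
`E'`. -/
structure CanonicalGenerator {n : ℕ} (f : MvPolynomial (Fin (n + 1)) ℂ)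
    (V : Set (Fin (n + 1) → ℂ)) (d : ℤ) where
  g : LocalChart f → (Fin n → ℂ) → ℂ
  holomorphic : ∀ c, AnalyticOnNhd ℂ (g c) {w | w ∈ c.source ∧ (c.pt w).1 ∈ V}
  ne_zero : ∀ c, ∀ w ∈ c.source, (c.pt w).1 ∈ V → g c w ≠ 0
  transform : ∀ c c' φ w, IsTransition c c' φ w → (c.pt w).1 ∈ V →
    g c w = c.l w c'.idx ^ d * g c' (φ w) * (jacobian φ w).det

namespace CanonicalGenerator

variable {n : ℕ} {f : MvPolynomial (Fin (n + 1)) ℂ} {V : Set (Fin (n + 1) → ℂ)} {d : ℤ}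

/-- The coefficient of `π^* ν` with respect to `dw_1 ∧ ⋯ ∧ dw_n` off `E'`. -/
def coeff (ν : CanonicalGenerator f V d) (c : LocalChart f) (w : Fin n → ℂ) : ℂ :=
  c.t w ^ d * ν.g c w

/-- The coefficient of `Ω_X = (√-1)^{n²} ν ∧ ν̄` off `E'`. -/
def volX (ν : CanonicalGenerator f V d) (c : LocalChart f) (w : Fin n → ℂ) : ℝ :=
  ‖ν.coeff c w‖ ^ 2

/-- The coefficient of the volume form `Ω_Y = (|σ_E|²)⁻¹ |σ_F|² Ω_X`, extended smoothly across
`E'` (see `volY_eq`), where `E = max(d,0) E'` and `F = max(-d,0) E'`. -/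
def volY (ν : CanonicalGenerator f V d) (hE : HermitianMetric f d.toNat)
    (hF : HermitianMetric f (-d).toNat) (c : LocalChart f) (w : Fin n → ℂ) : ℝ :=
  (hE.weight c w)⁻¹ * hF.weight c w * ‖ν.g c w‖ ^ 2

theorem coeff_transform (ν : CanonicalGenerator f V d) (c c' : LocalChart f)
    (φ : (Fin n → ℂ) → (Fin n → ℂ)) (w : Fin n → ℂ) (hφ : IsTransition c c' φ w)
    (hV : (c.pt w).1 ∈ V) :
    ν.coeff c w = ν.coeff c' (φ w) * (jacobian φ w).det := by
  have h1 : c'.t (φ w) = c.t w * c.l w c'.idx := by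
    have h2 := congrFun (congrArg Prod.fst hφ.pt_eq.self_of_nhds) c'.idx
    simp only [LocalChart.pt, affinePoint, Pi.smul_apply, smul_eq_mul, homog_same] at h2
    simp only [LocalChart.t, LocalChart.l, h2, mul_one]
  rw [coeff, coeff, ν.transform c c' φ w hφ hV, h1, mul_zpow]
  ring

theorem volY_eq (ν : CanonicalGenerator f V d) (hE : HermitianMetric f d.toNat)
    (hF : HermitianMetric f (-d).toNat) (c : LocalChart f) (w : Fin n → ℂ) (ht : c.t w ≠ 0) :
    ν.volY hE hF c w = (hE.normSq c w)⁻¹ * hF.normSq c w * ν.volX c w := by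
  have ht' : ‖c.t w‖ ≠ 0 := norm_ne_zero_iff.mpr ht
  have key : (‖c.t w‖ ^ (2 * d.toNat))⁻¹ * ‖c.t w‖ ^ (2 * (-d).toNat) * (‖c.t w‖ ^ d) ^ 2 = 1 := by
    rw [← zpow_natCast, ← zpow_natCast, ← zpow_natCast, ← zpow_neg, ← zpow_mul, ← zpow_add₀ ht',
      ← zpow_add₀ ht']
    have : -((2 * d.toNat : ℕ) : ℤ) + ((2 * (-d).toNat : ℕ) : ℤ) + d * ((2 : ℕ) : ℤ) = 0 := by
      omega
    rw [this, zpow_zero]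
  simp only [volY, volX, coeff, HermitianMetric.normSq, norm_mul, norm_zpow, mul_pow, mul_inv]
  linear_combination
    (-(hE.weight c w)⁻¹ * hF.weight c w * ‖ν.g c w‖ ^ 2) * key

end CanonicalGenerator

/-! ### The perturbed Monge-Ampère equation -/

/-- The right-hand side `(|σ_E|² + s) (|σ_F|² + s)⁻¹ Ω_Y`. -/
def rhs {n : ℕ} {f : MvPolynomial (Fin (n + 1)) ℂ} {V : Set (Fin (n + 1) → ℂ)} {d : ℤ}
    (ν : CanonicalGenerator f V d) (hE : HermitianMetric f d.toNat)
    (hF : HermitianMetric f (-d).toNat) (s : ℝ) (c : LocalChart f) (w : Fin n → ℂ) : ℝ :=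
  (hE.normSq c w + s) * (hF.normSq c w + s)⁻¹ * ν.volY hE hF c w

/-- `Φ` is a smooth subsolution with zero boundary values of the Dirichlet problem
`(ω₀ + s θ + √-1 ∂∂̄ Φ)^n = R` on `π⁻¹(U)`. -/
structure IsSubsolution {n : ℕ} (f : MvPolynomial (Fin (n + 1)) ℂ) (a : ℝ) (ω₀ θ : Coeff f) (s : ℝ)
    (R : LocalChart f → (Fin n → ℂ) → ℝ)
    (Φ : (Fin (n + 1) → ℂ) × Projectivization ℂ (Fin (n + 1) → ℂ) → ℝ) : Prop where
  smooth : IsSmooth f Φ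
  boundary : ∀ y ∈ strictTransform f, y.1 ∈ closure (domain f a) \ domain f a → Φ y = 0
  posDef : ∀ c : LocalChart f, ∀ w ∈ c.source, (c.pt w).1 ∈ domain f a →
    (ω₀ c w + (s : ℂ) • θ c w + ddbar f Φ c w).PosDef
  le : ∀ c : LocalChart f, ∀ w ∈ c.source, (c.pt w).1 ∈ domain f a →
    R c w ≤ topPower (ω₀ c w + (s : ℂ) • θ c w + ddbar f Φ c w)

end BlowupMA

end

/-! The pulled-back form `√-1 ∂∂̄ρ` is only semipositive on `Y`, since it degenerates along `E'`. It
is nevertheless nowhere zero, and one direction is enough. With `S = 1 + ∑ |z_j|²`, Cauchy–Schwarz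
bounds the Hessian of `log S` below by `S⁻²` times the rank-one form of `dz_i`
(`logHessian_sub_single_posSemidef`). On the piece `{l_i ≠ 0}` the function `z_i` is the fibre
coordinate `t`, so `√-1 ∂∂̄ρ ≥ S⁻² √-1 dt ∧ dt̄`, also on `E'`.

The equation `f(l) = 0` does not involve `t`, and Euler's identity gives a nonzero partial
derivative in an affine variable `v_j`. Hence `t` can replace `v_j` as a coordinate on `Y` near any
of its points (`exists_adapted_chart`). In such a chart the determinant of `sθ + A√-1 ∂∂̄ρ` plus any
semipositive form is at least `A S⁻²` times a diagonal cofactor of `sθ`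
(`le_topPower_of_transition`). That cofactor is positive, so the bound grows linearly in `A`.

The right-hand side is continuous because `s > 0`, so locally it is dominated once `A` is large; `S
< e^a` on the domain makes the threshold explicit (`exists_local_bound`). The closure of `π⁻¹(U)` is
covered by `n + 1` compact sets of affine coordinates, which yields one threshold for all points and
charts (`exists_uniform_bound`). Strict positivity comes from `sθ` alone. -/

open scoped ContDiff ComplexOrder

noncomputable section

namespace BlowupMA

open Matrix

/-! ### Determinant inequalities for positive matrices. -/

section Determinants

variable {ι : Type*} [Fintype ι] [DecidableEq ι]

theorem one_le_det_re_of_sub_one_posSemidef {M : Matrix ι ι ℂ} (hM : (M - 1).PosSemidef) :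
    1 ≤ M.det.re := by
  have hH : M.IsHermitian := by
    have := hM.isHermitian.add (isHermitian_one (n := ι) (α := ℂ))
    simpa using this
  have h1 : ∀ i, 1 ≤ hH.eigenvalues i := by
    intro i
    rw [hH.eigenvalues_eq]
    have h2 := hM.re_dotProduct_nonneg (hH.eigenvectorBasis i).ofLp
    have h3 : RCLike.re (star (hH.eigenvectorBasis i).ofLp ⬝ᵥ (hH.eigenvectorBasis i).ofLp)
        = 1 := by
      have := hH.eigenvectorBasis.orthonormal.1 i
      have h4 := inner_self_eq_norm_sq (𝕜 := ℂ) (hH.eigenvectorBasis i)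
      rw [this, EuclideanSpace.inner_eq_star_dotProduct, dotProduct_comm] at h4
      simpa using h4
    rw [sub_mulVec, one_mulVec, dotProduct_sub, map_sub, h3] at h2
    linarith
  rw [hH.det_eq_prod_eigenvalues]
  norm_cast
  exact Finset.prod_induction _ (fun x : ℝ => 1 ≤ x) (fun _ _ => one_le_mul_of_one_le_of_one_le)
    le_rfl fun i _ => h1 i

open scoped MatrixOrder in
-- Writing `P = BᴴB` gives `P + Q = Bᴴ(1 + B⁻¹ᴴ Q B⁻¹)B`. The middle factor has all eigenvalues at
-- least one, so its determinant is at least one.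
theorem det_re_le_det_add_re {P Q : Matrix ι ι ℂ} (hP : P.PosDef) (hQ : Q.PosSemidef) :
    P.det.re ≤ (P + Q).det.re := by
  obtain ⟨B, hB, rfl⟩ : ∃ B : Matrix ι ι ℂ, IsUnit B ∧ P = Bᴴ * B := by
    obtain ⟨B, hB⟩ := CStarAlgebra.nonneg_iff_eq_star_mul_self.mp hP.posSemidef.nonneg
    refine ⟨B, ?_, hB⟩
    rw [isUnit_iff_isUnit_det, isUnit_iff_ne_zero]
    intro h
    have := hP.det_pos
    rw [hB, det_mul, h, mul_zero] at this
    exact lt_irrefl _ this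
  have hdet : IsUnit B.det := (isUnit_iff_isUnit_det B).1 hB
  have h1 : (Bᴴ * B + Q) = Bᴴ * (1 + B⁻¹ᴴ * Q * B⁻¹) * B := by
    have e1 : Bᴴ * B⁻¹ᴴ = 1 := by
      rw [← conjTranspose_mul, nonsing_inv_mul _ hdet, conjTranspose_one]
    have e2 : B⁻¹ * B = 1 := nonsing_inv_mul _ hdet
    rw [mul_add, add_mul, mul_one]
    congr 1
    rw [← mul_assoc, ← mul_assoc, e1, one_mul, mul_assoc, e2, mul_one]
  have h2 := one_le_det_re_of_sub_one_posSemidef (M := 1 + B⁻¹ᴴ * Q * B⁻¹)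
    (by simpa using hQ.conjTranspose_mul_mul_same B⁻¹)
  have h3 : (Bᴴ * (1 + B⁻¹ᴴ * Q * B⁻¹) * B).det
      = ((‖B.det‖ ^ 2 : ℝ) : ℂ) * (1 + B⁻¹ᴴ * Q * B⁻¹).det := by
    rw [det_mul, det_mul, det_conjTranspose]
    have := Complex.conj_mul' B.det
    push_cast
    rw [← this]
    simp only [Complex.star_def]
    ring
  have h4 : (Bᴴ * B).det = ((‖B.det‖ ^ 2 : ℝ) : ℂ) := by
    rw [det_mul, det_conjTranspose]
    push_cast
    exact Complex.conj_mul' B.det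
  rw [h1, h3, h4, Complex.re_ofReal_mul, Complex.ofReal_re]
  nlinarith [sq_nonneg ‖B.det‖]

/-- The determinant is affine in row `j`. This is the source of the linear growth in `A`. -/
theorem det_add_smul_single {R : Type*} [CommRing R] (P : Matrix ι ι R) (x : R) (j : ι) :
    (P + x • Matrix.single j j 1).det = P.det + x * P.adjugate j j := by
  have h : P + x • Matrix.single j j 1 = P.updateRow j (P j + x • Pi.single j 1) := by
    ext p q
    by_cases hp : p = j
    · subst hp
      by_cases hq : q = p
      · subst hq; simp
      · simp [Matrix.single, hq, Ne.symm hq]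
    · simp [updateRow_ne hp, Matrix.single, Ne.symm hp]
  rw [h, det_updateRow_add, det_updateRow_smul, adjugate_apply]
  simp

theorem adjugate_diag_re_pos {P : Matrix ι ι ℂ} (hP : P.PosDef) (j : ι) :
    0 < (P.adjugate j j).re := by
  have h1 : P.adjugate = P.det • P⁻¹ := by
    rw [inv_def, smul_smul, Ring.mul_inverse_cancel _ ((isUnit_iff_isUnit_det P).1 hP.isUnit),
      one_smul]
  have h2 : 0 < P.adjugate j j := by
    rw [h1, Matrix.smul_apply, smul_eq_mul]
    exact mul_pos hP.det_pos hP.inv.diag_pos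
  exact (Complex.pos_iff.1 h2).1

theorem det_transpose_mul_mul_map_star (J M : Matrix ι ι ℂ) :
    (Jᵀ * M * J.map star).det.re = ‖J.det‖ ^ 2 * M.det.re := by
  have h : (J.map star).det = star J.det := by
    rw [← det_conjTranspose, ← det_transpose]; rfl
  rw [det_mul, det_mul, det_transpose, h]
  have h2 : J.det * M.det * star J.det = ((‖J.det‖ ^ 2 : ℝ) : ℂ) * M.det := by
    have := Complex.mul_conj' J.det
    push_cast
    rw [← this]
    simp only [Complex.star_def]
    ring
  rw [h2, Complex.re_ofReal_mul]

end Determinants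

/-! ### Calculus of Wirtinger derivatives. -/

section Wirtinger

variable {n : ℕ} {g h : (Fin n → ℂ) → ℂ} {w : Fin n → ℂ}

theorem single_I_eq_smul (j : Fin n) :
    (Pi.single j Complex.I : Fin n → ℂ) = Complex.I • Pi.single j 1 := by
  rw [← Pi.single_smul, smul_eq_mul, mul_one]

theorem dWirt_of_differentiableAt (j : Fin n) (hg : DifferentiableAt ℂ g w) :
    dWirt j g w = fderiv ℂ g w (Pi.single j 1) := by
  have h1 : fderiv ℝ g w = (fderiv ℂ g w).restrictScalars ℝ :=
    (hg.hasFDerivAt.restrictScalars ℝ).fderiv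
  rw [dWirt, h1, single_I_eq_smul]
  simp only [ContinuousLinearMap.coe_restrictScalars', map_smul, smul_eq_mul]
  linear_combination (-1 / 2 * fderiv ℂ g w (Pi.single j 1)) * Complex.I_mul_I

theorem dWirt_conj_of_differentiableAt (j : Fin n) (hg : DifferentiableAt ℂ g w) :
    dWirt j (fun v => star (g v)) w = 0 := by
  have h1 := (hg.hasFDerivAt.restrictScalars ℝ).star
  rw [dWirt, h1.fderiv, single_I_eq_smul]
  simp only [ContinuousLinearMap.comp_apply, ContinuousLinearMap.coe_restrictScalars', map_smul,
    smul_eq_mul, ContinuousLinearEquiv.coe_coe, starL'_apply, Complex.star_def, map_mul,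
    Complex.conj_I]
  linear_combination (1 / 2 * starRingEnd ℂ (fderiv ℂ g w (Pi.single j 1))) * Complex.I_mul_I

theorem dWirt_mul (j : Fin n) (hg : DifferentiableAt ℝ g w) (hh : DifferentiableAt ℝ h w) :
    dWirt j (fun v => g v * h v) w = dWirt j g w * h w + g w * dWirt j h w := by
  simp only [dWirt, (hg.hasFDerivAt.fun_mul hh.hasFDerivAt).fderiv, _root_.add_apply,
    _root_.smul_apply, smul_eq_mul]
  ring

theorem dWirt_const_add (j : Fin n) (c : ℂ) :
    dWirt j (fun v => c + g v) w = dWirt j g w := by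
  simp only [dWirt, fderiv_const_add]

theorem dWirt_sum {ι : Type*} (s : Finset ι) {u : ι → (Fin n → ℂ) → ℂ} (j : Fin n)
    (hu : ∀ i ∈ s, DifferentiableAt ℝ (u i) w) :
    dWirt j (fun v => ∑ i ∈ s, u i v) w = ∑ i ∈ s, dWirt j (u i) w := by
  simp only [dWirt, (HasFDerivAt.fun_sum fun i hi => (hu i hi).hasFDerivAt).fderiv,
    _root_.sum_apply]
  rw [← Finset.mul_sum, Finset.sum_sub_distrib, Finset.mul_sum]

theorem dWirt_inv (j : Fin n) (hg : DifferentiableAt ℝ g w) (h0 : g w ≠ 0) :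
    dWirt j (fun v => (g v)⁻¹) w = -dWirt j g w / g w ^ 2 := by
  have h1 : HasFDerivAt (fun v => (g v)⁻¹) _ w :=
    (hasDerivAt_inv h0).comp_hasFDerivAt_of_eq w hg.hasFDerivAt rfl
  simp only [dWirt, h1.fderiv]
  simp
  ring

end Wirtinger

/-! ### The complex Hessian of `log (1 + ∑ |z_j|²)` composed with a holomorphic map. -/

section Potential

variable {n N : ℕ}

/-- The complex Jacobian matrix `(∂Z_p / ∂w_j)_{p j}` of a map into `ℂ^N`. -/
def jac (Z : (Fin n → ℂ) → Fin N → ℂ) (w : Fin n → ℂ) : Matrix (Fin N) (Fin n) ℂ :=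
  Matrix.of fun p j => fderiv ℂ Z w (Pi.single j 1) p

/-- The function `1 + ∑ |z_j|²`. -/
def oneAddNormSq (z : Fin N → ℂ) : ℝ := 1 + ∑ j, ‖z j‖ ^ 2

theorem oneAddNormSq_pos (z : Fin N → ℂ) : 0 < oneAddNormSq z := by
  unfold oneAddNormSq; positivity

theorem ofReal_oneAddNormSq (z : Fin N → ℂ) :
    (oneAddNormSq z : ℂ) = 1 + ∑ j, z j * star (z j) := by
  simp [oneAddNormSq, Complex.mul_conj']

/-- The complex Hessian of `log (1 + ∑ |z_j|²)`. -/
def logHessian (z : Fin N → ℂ) : Matrix (Fin N) (Fin N) ℂ :=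
  ((oneAddNormSq z)⁻¹ : ℂ) • 1 - ((oneAddNormSq z ^ 2)⁻¹ : ℂ) • vecMulVec (star z) z

theorem hasFDerivAt_apply {Z : (Fin n → ℂ) → Fin N → ℂ} {w : Fin n → ℂ}
    (hZ : DifferentiableAt ℂ Z w) (p : Fin N) :
    HasFDerivAt (fun v => Z v p) ((ContinuousLinearMap.proj p).comp (fderiv ℂ Z w)) w :=
  hasFDerivAt_pi'.1 hZ.hasFDerivAt p

theorem dbarWirt_log (k : Fin n) {Z : (Fin n → ℂ) → Fin N → ℂ} {w : Fin n → ℂ}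
    (hZ : DifferentiableAt ℂ Z w) (A a : ℝ) :
    dbarWirt k (fun v => ((A * (Real.log (oneAddNormSq (Z v)) - a) : ℝ) : ℂ)) w
      = A * ((oneAddNormSq (Z w) : ℂ)⁻¹ * ∑ p, Z w p * star (jac Z w p k)) := by
  have h1 : ∀ p, HasFDerivAt (fun v => Z v p) _ w := fun p =>
    (hasFDerivAt_apply hZ p).restrictScalars ℝ
  have h2 : HasFDerivAt (fun v => oneAddNormSq (Z v)) _ w :=
    (HasFDerivAt.fun_sum (u := Finset.univ) fun p _ => (h1 p).norm_sq).const_add 1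
  have h3 := Complex.ofRealCLM.hasFDerivAt.comp w
    (((h2.log (oneAddNormSq_pos (Z w)).ne').sub_const a).const_mul A)
  have h4 : fderiv ℝ (fun v => ((A * (Real.log (oneAddNormSq (Z v)) - a) : ℝ) : ℂ)) w = _ :=
    h3.fderiv
  have h5 : ∀ x y : ℂ, (((2 * inner ℝ x y : ℝ)) : ℂ) = x * star y + star x * y := by
    intro x y
    rw [Complex.inner]
    push_cast
    rw [Complex.re_eq_add_conj]
    simp
    ring
  have h6 : ∀ u, fderiv ℝ (fun v => ((A * (Real.log (oneAddNormSq (Z v)) - a) : ℝ) : ℂ)) w u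
      = A * ((oneAddNormSq (Z w) : ℂ)⁻¹ * ∑ p, (Z w p * star (fderiv ℂ Z w u p)
        + star (Z w p) * fderiv ℂ Z w u p)) := by
    intro u
    rw [h4]
    simp only [ContinuousLinearMap.comp_apply, Complex.ofRealCLM_apply, _root_.smul_apply,
      smul_eq_mul, _root_.sum_apply, ContinuousLinearMap.coe_restrictScalars', innerSL_apply_apply,
      ContinuousLinearMap.proj_apply, nsmul_eq_mul, Nat.cast_ofNat]
    push_cast
    congr 2
    refine Finset.sum_congr rfl fun p _ => ?_
    rw [← h5]
    push_cast
    rfl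
  have h7 : ∀ p, fderiv ℂ Z w (Pi.single k 1) p = jac Z w p k := fun p => rfl
  rw [dbarWirt, h6, h6, single_I_eq_smul]
  simp only [map_smul, Pi.smul_apply, h7, smul_eq_mul, Finset.sum_add_distrib, star_mul',
    Complex.star_def, Complex.conj_I]
  have h8 : ∑ p, Z w p * (-Complex.I * starRingEnd ℂ (jac Z w p k))
      = -Complex.I * ∑ p, Z w p * starRingEnd ℂ (jac Z w p k) := by
    rw [Finset.mul_sum]; exact Finset.sum_congr rfl fun p _ => by ring
  have h9 : ∑ p, starRingEnd ℂ (Z w p) * (Complex.I * jac Z w p k)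
      = Complex.I * ∑ p, starRingEnd ℂ (Z w p) * jac Z w p k := by
    rw [Finset.mul_sum]; exact Finset.sum_congr rfl fun p _ => by ring
  rw [h8, h9]
  -- Multiplication by `I` cancels the complex-linear part of the differential and doubles the
  -- conjugate-linear part.
  linear_combination (1 / 2 * A * (oneAddNormSq (Z w) : ℂ)⁻¹ *
    (∑ p, starRingEnd ℂ (Z w p) * jac Z w p k - ∑ p, Z w p * starRingEnd ℂ (jac Z w p k)))
    * Complex.I_mul_I

theorem dWirt_dbarWirt_log (j k : Fin n) {Z : (Fin n → ℂ) → Fin N → ℂ} {w : Fin n → ℂ}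
    (hZ : AnalyticAt ℂ Z w) (A a : ℝ) :
    dWirt j (dbarWirt k fun v => ((A * (Real.log (oneAddNormSq (Z v)) - a) : ℝ) : ℂ)) w
      = A * ((oneAddNormSq (Z w) : ℂ)⁻¹ * ∑ p, jac Z w p j * star (jac Z w p k)
        - ((oneAddNormSq (Z w) : ℂ) ^ 2)⁻¹ * (∑ p, star (Z w p) * jac Z w p j)
          * ∑ p, Z w p * star (jac Z w p k)) := by
  -- A second derivative follows, so the first-order formula is needed on a neighbourhood; this is
  -- where analyticity of `Z` enters.
  have hev : (dbarWirt k fun v => ((A * (Real.log (oneAddNormSq (Z v)) - a) : ℝ) : ℂ))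
      =ᶠ[nhds w] fun v => (A : ℂ) * ((oneAddNormSq (Z v) : ℂ)⁻¹
        * ∑ p, Z v p * star (jac Z v p k)) := by
    filter_upwards [hZ.eventually_analyticAt] with v hv
    exact dbarWirt_log k hv.differentiableAt A a
  have hcongr : ∀ {u u' : (Fin n → ℂ) → ℂ}, u =ᶠ[nhds w] u' → dWirt j u w = dWirt j u' w := by
    intro u u' h
    rw [dWirt, dWirt, h.fderiv_eq]
  rw [hcongr hev]
  have hZp : ∀ p, DifferentiableAt ℂ (fun v => Z v p) w := fun p =>
    (hasFDerivAt_apply hZ.differentiableAt p).differentiableAt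
  have hJp : ∀ p, DifferentiableAt ℂ (fun v => jac Z v p k) w := fun p =>
    (differentiableAt_pi.1 (hZ.fderiv.differentiableAt.clm_apply
      (differentiableAt_const (Pi.single k 1)))) p
  have hZ' : ∀ p, DifferentiableAt ℝ (fun v => Z v p) w := fun p => (hZp p).restrictScalars ℝ
  have hZs : ∀ p, DifferentiableAt ℝ (fun v => star (Z v p)) w := fun p => (hZ' p).star
  have hJs : ∀ p, DifferentiableAt ℝ (fun v => star (jac Z v p k)) w := fun p =>
    ((hJp p).restrictScalars ℝ).star
  have hS : DifferentiableAt ℝ (fun v => (oneAddNormSq (Z v) : ℂ)) w := by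
    simp only [ofReal_oneAddNormSq]
    exact (DifferentiableAt.fun_sum fun p _ => (hZ' p).fun_mul (hZs p)).const_add 1
  have hS0 : (oneAddNormSq (Z w) : ℂ) ≠ 0 := by exact_mod_cast (oneAddNormSq_pos (Z w)).ne'
  have hdZ : ∀ p, dWirt j (fun v => Z v p) w = jac Z w p j := fun p => by
    rw [dWirt_of_differentiableAt j (hZp p), (hasFDerivAt_apply hZ.differentiableAt p).fderiv]
    rfl
  have hdS : dWirt j (fun v => (oneAddNormSq (Z v) : ℂ)) w = ∑ p, star (Z w p) * jac Z w p j := by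
    simp only [ofReal_oneAddNormSq]
    rw [dWirt_const_add, dWirt_sum _ _ fun p _ => (hZ' p).fun_mul (hZs p)]
    refine Finset.sum_congr rfl fun p _ => ?_
    rw [dWirt_mul j (hZ' p) (hZs p), dWirt_conj_of_differentiableAt j (hZp p), hdZ]
    ring
  have hdT : dWirt j (fun v => ∑ p, Z v p * star (jac Z v p k)) w
      = ∑ p, jac Z w p j * star (jac Z w p k) := by
    rw [dWirt_sum _ _ fun p _ => (hZ' p).fun_mul (hJs p)]
    refine Finset.sum_congr rfl fun p _ => ?_
    rw [dWirt_mul j (hZ' p) (hJs p), dWirt_conj_of_differentiableAt j (hJp p), hdZ]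
    ring
  have hT : DifferentiableAt ℝ (fun v => ∑ p, Z v p * star (jac Z v p k)) w :=
    DifferentiableAt.fun_sum fun p _ => (hZ' p).fun_mul (hJs p)
  have hconst : dWirt j (fun _ : Fin n → ℂ => (A : ℂ)) w = 0 := by
    simp [dWirt]
  rw [dWirt_mul j (differentiableAt_const _) ((hS.fun_inv hS0).fun_mul hT), hconst,
    dWirt_mul j (hS.fun_inv hS0) hT, dWirt_inv j hS hS0, hdS, hdT]
  field_simp
  ring

theorem jac_conj_logHessian_apply (J : Matrix (Fin N) (Fin n) ℂ) (z : Fin N → ℂ) (j k : Fin n) :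
    (Jᵀ * logHessian z * J.map star) j k
      = (oneAddNormSq z : ℂ)⁻¹ * ∑ p, J p j * star (J p k)
        - ((oneAddNormSq z : ℂ) ^ 2)⁻¹ * (∑ p, star (z p) * J p j)
          * ∑ p, z p * star (J p k) := by
  rw [logHessian, Matrix.mul_sub, Matrix.sub_mul, Matrix.sub_apply]
  congr 1
  · rw [Matrix.mul_smul, Matrix.smul_mul, Matrix.mul_one, Matrix.smul_apply, smul_eq_mul]
    rfl
  · rw [Matrix.mul_smul, Matrix.smul_mul, mul_vecMulVec, vecMulVec_mul, Matrix.smul_apply,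
      vecMulVec_apply, smul_eq_mul, mul_assoc]
    congr 2
    exact dotProduct_comm (fun p => J p j) (star z)

/-- Cauchy–Schwarz gives `|z·y|² ≤ (S - 1)|y|²`, so the Hessian form `S⁻¹|y|² - S⁻²|z·y|²` is at
least `S⁻²|y|²`, hence at least `S⁻²|y_i|²`. -/
theorem logHessian_sub_single_posSemidef (z : Fin N → ℂ) (i : Fin N) :
    (logHessian z - ((oneAddNormSq z ^ 2)⁻¹ : ℂ) • Matrix.single i i 1).PosSemidef := by
  have hS := oneAddNormSq_pos z
  set S := oneAddNormSq z with hSdef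
  have hH : (logHessian z - ((S ^ 2)⁻¹ : ℂ) • Matrix.single i i 1).IsHermitian := by
    rw [logHessian, ← hSdef, Matrix.IsHermitian]
    simp [conjTranspose_sub, conjTranspose_smul, conjTranspose_vecMulVec]
  refine .of_dotProduct_mulVec_nonneg hH fun y => ?_
  have hq : star y ⬝ᵥ (logHessian z - ((S ^ 2)⁻¹ : ℂ) • Matrix.single i i 1) *ᵥ y
      = (((S⁻¹ * ∑ p, ‖y p‖ ^ 2 - (S ^ 2)⁻¹ * ‖z ⬝ᵥ y‖ ^ 2 - (S ^ 2)⁻¹ * ‖y i‖ ^ 2 : ℝ)) : ℂ) := by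
    have e1 : star y ⬝ᵥ y = ((∑ p, ‖y p‖ ^ 2 : ℝ) : ℂ) := by
      simp [dotProduct, Complex.conj_mul']
    have e2 : star y ⬝ᵥ (vecMulVec (star z) z *ᵥ y) = ((‖z ⬝ᵥ y‖ ^ 2 : ℝ) : ℂ) := by
      rw [vecMulVec_mulVec, op_smul_eq_smul, dotProduct_smul, star_dotProduct_star,
        smul_eq_mul]
      push_cast
      exact Complex.mul_conj' _
    have e3 : star y ⬝ᵥ (Matrix.single i i (1 : ℂ) *ᵥ y) = ((‖y i‖ ^ 2 : ℝ) : ℂ) := by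
      rw [single_mulVec, one_mul]
      change star y ⬝ᵥ Pi.single i (y i) = _
      rw [dotProduct_single]
      push_cast
      exact Complex.conj_mul' _
    rw [logHessian, ← hSdef, sub_mulVec, sub_mulVec, smul_mulVec, smul_mulVec, smul_mulVec,
      one_mulVec, dotProduct_sub, dotProduct_sub, dotProduct_smul, dotProduct_smul,
      dotProduct_smul, e1, e2, e3]
    push_cast
    simp only [smul_eq_mul]
  rw [hq]
  norm_cast
  have hcs : ‖z ⬝ᵥ y‖ ^ 2 ≤ (∑ p, ‖z p‖ ^ 2) * ∑ p, ‖y p‖ ^ 2 := by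
    have h1 : ‖z ⬝ᵥ y‖ ≤ ∑ p, ‖z p‖ * ‖y p‖ := by
      refine (norm_sum_le _ _).trans_eq ?_
      simp
    exact (pow_le_pow_left₀ (norm_nonneg _) h1 2).trans (Finset.sum_mul_sq_le_sq_mul_sq _ _ _)
  have hi : ‖y i‖ ^ 2 ≤ ∑ p, ‖y p‖ ^ 2 :=
    Finset.single_le_sum (f := fun p => ‖y p‖ ^ 2) (fun p _ => sq_nonneg _) (Finset.mem_univ i)
  have hz : ∑ p, ‖z p‖ ^ 2 = S - 1 := by rw [hSdef, oneAddNormSq]; ring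
  rw [hz] at hcs
  have : S⁻¹ * ∑ p, ‖y p‖ ^ 2 = (S ^ 2)⁻¹ * (S * ∑ p, ‖y p‖ ^ 2) := by field_simp
  rw [this, sub_sub, ← mul_add, ← mul_sub]
  refine mul_nonneg (by positivity) ?_
  nlinarith

end Potential

/-! ### Homogeneity, Euler's identity and affine equations of the strict transform. -/

section Polynomials

theorem hasFDerivAt_eval {N : ℕ} (f : MvPolynomial (Fin N) ℂ) (z : Fin N → ℂ) :
    HasFDerivAt (fun z : Fin N → ℂ => MvPolynomial.eval z f)
      (∑ k, MvPolynomial.eval z (MvPolynomial.pderiv k f) •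
        (ContinuousLinearMap.proj k : (Fin N → ℂ) →L[ℂ] ℂ)) z := by
  induction f using MvPolynomial.induction_on with
  | C a =>
    simp only [MvPolynomial.eval_C]
    refine (hasFDerivAt_const a z).congr_fderiv (ContinuousLinearMap.ext fun v => ?_)
    simp
  | add p q hp hq =>
    simp only [map_add]
    refine (hp.fun_add hq).congr_fderiv (ContinuousLinearMap.ext fun v => ?_)
    simp [add_mul, Finset.sum_add_distrib]
  | mul_X p i hp =>
    simp only [map_mul, MvPolynomial.eval_X, MvPolynomial.pderiv_mul, map_add,
      MvPolynomial.pderiv_X]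
    refine (hp.fun_mul (ContinuousLinearMap.proj (R := ℂ) (φ := fun _ : Fin N => ℂ)
      i).hasFDerivAt).congr_fderiv (ContinuousLinearMap.ext fun v => ?_)
    have h : ∀ k, MvPolynomial.eval z (Pi.single (M := fun _ => MvPolynomial (Fin N) ℂ) k 1 i)
        = if i = k then 1 else 0 := fun k => by
      rw [Pi.single_apply]; split <;> simp
    simp only [_root_.add_apply, _root_.smul_apply, _root_.sum_apply,
      ContinuousLinearMap.proj_apply, smul_eq_mul, h, mul_ite, mul_one, mul_zero, add_mul, ite_mul,
      zero_mul, Finset.sum_add_distrib, Finset.sum_ite_eq, Finset.mem_univ, if_true, Finset.mul_sum]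
    rw [add_comm]
    congr 1
    exact Finset.sum_congr rfl fun k _ => by ring

theorem eval_smul_of_isHomogeneous {σ : Type*} {m : ℕ} {f : MvPolynomial σ ℂ}
    (hf : f.IsHomogeneous m) (x : ℂ) (z : σ → ℂ) :
    MvPolynomial.eval (x • z) f = x ^ m * MvPolynomial.eval z f := by
  rw [MvPolynomial.eval_eq, MvPolynomial.eval_eq, Finset.mul_sum]
  refine Finset.sum_congr rfl fun d hd => ?_
  have h1 : ∑ i ∈ d.support, d i = m := by
    have := hf (MvPolynomial.mem_support_iff.1 hd)
    simpa [Finsupp.weight_apply, Finsupp.sum] using this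
  simp only [Pi.smul_apply, smul_eq_mul, mul_pow, Finset.prod_mul_distrib,
    Finset.prod_pow_eq_pow_sum, h1]
  ring

variable {n : ℕ} {f : MvPolynomial (Fin (n + 1)) ℂ}

theorem homog_succAbove (i : Fin (n + 1)) (v : Fin n → ℂ) (k : Fin n) :
    homog i v (i.succAbove k) = v k :=
  Fin.insertNth_apply_succAbove (α := fun _ => ℂ) i 1 v k

/-- By Euler's identity `∑ l_k ∂_k f = m f = 0` at `l`. Since `l_i = 1`, vanishing of all the other
partials would force `∂_i f = 0` too, against smoothness. -/
theorem exists_pderiv_succAbove_ne_zero {m : ℕ} (hf : f.IsHomogeneous m)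
    (hsing : SmoothAwayFromOrigin f) (i : Fin (n + 1)) {v : Fin n → ℂ}
    (hv : MvPolynomial.eval (homog i v) f = 0) :
    ∃ j : Fin n, MvPolynomial.eval (homog i v) (MvPolynomial.pderiv (i.succAbove j) f) ≠ 0 := by
  by_contra! h
  obtain ⟨k, hk⟩ := hsing _ (homog_ne_zero i v) hv
  have euler := congrArg (MvPolynomial.eval (homog i v)) hf.sum_X_mul_pderiv
  simp only [map_sum, map_mul, MvPolynomial.eval_X, map_nsmul, hv, smul_zero] at euler
  rw [Fin.sum_univ_succAbove _ i] at euler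
  simp only [h, mul_zero, Finset.sum_const_zero, add_zero, homog_same, one_mul] at euler
  cases k using Fin.succAboveCases i with
  | x => exact hk euler
  | p k => exact hk (h k)

/-- Homogeneity makes the condition independent of the arbitrary representative `rep`; the blow-up
equations hold automatically. -/
theorem affinePoint_mem_strictTransform_iff {m : ℕ} (hf : f.IsHomogeneous m) (i : Fin (n + 1))
    (p : ℂ × (Fin n → ℂ)) :
    affinePoint i p ∈ strictTransform f ↔ MvPolynomial.eval (homog i p.2) f = 0 := by
  obtain ⟨x, hx⟩ := Projectivization.exists_smul_eq_mk_rep ℂ (homog i p.2) (homog_ne_zero i p.2)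
  have hx' : (x : ℂ) • homog i p.2 = (affinePoint i p).2.rep := hx
  rw [strictTransform, Set.mem_ofPred_eq, ← hx', eval_smul_of_isHomogeneous hf]
  constructor
  · rintro ⟨-, h⟩
    exact (mul_eq_zero.1 h).resolve_left (pow_ne_zero _ x.ne_zero)
  · intro h
    refine ⟨fun a b => ?_, by rw [h, mul_zero]⟩
    rw [← hx']
    simp only [affinePoint, Pi.smul_apply, smul_eq_mul]
    ring

end Polynomials

/-! ### Changes of affine coordinates on the blow-up. -/

section AffineCoordinates

variable {n : ℕ}

theorem analyticAt_homog (i q : Fin (n + 1)) (v : Fin n → ℂ) :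
    AnalyticAt ℂ (fun v => homog i v q) v := by
  cases q using Fin.succAboveCases i with
  | x => simpa only [homog_same] using analyticAt_const
  | p k =>
    simp only [homog_succAbove]
    exact (ContinuousLinearMap.proj (R := ℂ) (φ := fun _ : Fin n => ℂ) k).analyticAt v

/-- The coordinates of the point `affinePoint i p` in the affine piece `{l_{i'} ≠ 0}`. -/
def affineChange (i i' : Fin (n + 1)) (p : ℂ × (Fin n → ℂ)) : ℂ × (Fin n → ℂ) :=
  (p.1 * homog i p.2 i', fun k => homog i p.2 (i'.succAbove k) / homog i p.2 i')

theorem homog_affineChange {i i' : Fin (n + 1)} {p : ℂ × (Fin n → ℂ)} (h : homog i p.2 i' ≠ 0) :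
    homog i' (affineChange i i' p).2 = (homog i p.2 i')⁻¹ • homog i p.2 := by
  ext q
  cases q using Fin.succAboveCases i' with
  | x => simp [homog_same, h]
  | p k => rw [homog_succAbove]; simp [affineChange, div_eq_inv_mul]

theorem affinePoint_affineChange {i i' : Fin (n + 1)} {p : ℂ × (Fin n → ℂ)}
    (h : homog i p.2 i' ≠ 0) : affinePoint i' (affineChange i i' p) = affinePoint i p := by
  refine Prod.ext ?_ ?_
  · change (p.1 * homog i p.2 i') • homog i' (affineChange i i' p).2 = p.1 • homog i p.2
    rw [homog_affineChange h, smul_smul, mul_assoc, mul_inv_cancel₀ h, mul_one]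
  · exact (Projectivization.mk_eq_mk_iff' ℂ _ _ _ _).2 ⟨_, (homog_affineChange h).symm⟩

theorem homog_ne_zero_of_affinePoint_eq {i i' : Fin (n + 1)} {p p' : ℂ × (Fin n → ℂ)}
    (h : affinePoint i p = affinePoint i' p') : homog i p.2 i' ≠ 0 := by
  obtain ⟨x, hx⟩ := (Projectivization.mk_eq_mk_iff' ℂ _ _ _ _).1 (congrArg Prod.snd h).symm
  intro h0
  have := congrFun hx i'
  rw [homog_same, Pi.smul_apply, h0, smul_zero] at this
  exact zero_ne_one this

theorem affinePoint_injective (i : Fin (n + 1)) : Function.Injective (affinePoint i) := by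
  intro p p' h
  refine Prod.ext ?_ ?_
  · have := congrFun (congrArg Prod.fst h) i
    simpa [affinePoint, homog_same] using this
  · obtain ⟨x, hx⟩ := (Projectivization.mk_eq_mk_iff' ℂ _ _ _ _).1 (congrArg Prod.snd h)
    have h1 := congrFun hx i
    rw [Pi.smul_apply, homog_same, homog_same, smul_eq_mul, mul_one] at h1
    rw [h1, one_smul] at hx
    ext k
    rw [← homog_succAbove i p.2, ← homog_succAbove i p'.2, hx]

theorem analyticAt_affineChange (i i' : Fin (n + 1)) {p : ℂ × (Fin n → ℂ)}
    (h : homog i p.2 i' ≠ 0) : AnalyticAt ℂ (affineChange i i') p := by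
  have hh : ∀ q, AnalyticAt ℂ (fun p : ℂ × (Fin n → ℂ) => homog i p.2 q) p := fun q =>
    (analyticAt_homog i q p.2).fun_comp analyticAt_snd
  exact (analyticAt_fst.mul (hh i')).prod (AnalyticAt.pi fun k => (hh _).div (hh i') h)

end AffineCoordinates

/-! ### The potential `ρ` in charts of `Y`. -/

section Charts

variable {n : ℕ} {f : MvPolynomial (Fin (n + 1)) ℂ}

theorem LocalChart.analyticAt_fst (c : LocalChart f) {w : Fin n → ℂ} (hw : w ∈ c.source) :
    AnalyticAt ℂ (fun v => (c.pt v).1) w := by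
  have h := c.holomorphic w hw
  have h1 : AnalyticAt ℂ (fun v => (c.coord v).1) w :=
    _root_.analyticAt_fst.fun_comp h
  have h2 : AnalyticAt ℂ (fun v => (c.coord v).2) w := analyticAt_snd.fun_comp h
  exact AnalyticAt.pi fun q => h1.mul ((analyticAt_homog c.idx q _).fun_comp h2)

theorem ddbar_rho (c : LocalChart f) {w : Fin n → ℂ} (hw : w ∈ c.source) (A a : ℝ) :
    ddbar f (fun y => A * (rho y.1 - a)) c w
      = (A : ℂ) • ((jac (fun v => (c.pt v).1) w)ᵀ * logHessian (c.pt w).1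
        * (jac (fun v => (c.pt v).1) w).map star) := by
  ext j k
  rw [Matrix.smul_apply, jac_conj_logHessian_apply, smul_eq_mul]
  exact dWirt_dbarWirt_log j k (c.analyticAt_fst hw) A a

theorem map_star_eq_conjTranspose {ι κ : Type*} (J : Matrix ι κ ℂ) : J.map star = Jᵀᴴ := rfl

/-- Congruence of the Hessian bound by the Jacobian of `π`. The index `i` need not be that of `c`:
it will be the index of an adapted chart. -/
theorem ddbar_rho_sub_posSemidef (c : LocalChart f) {w : Fin n → ℂ} (hw : w ∈ c.source)
    {A : ℝ} (hA : 0 ≤ A) (a : ℝ) (i : Fin (n + 1)) :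
    (ddbar f (fun y => A * (rho y.1 - a)) c w
      - ((A * (oneAddNormSq (c.pt w).1 ^ 2)⁻¹ : ℝ) : ℂ) •
        ((jac (fun v => (c.pt v).1) w)ᵀ * Matrix.single i i (1 : ℂ)
          * (jac (fun v => (c.pt v).1) w).map star)).PosSemidef := by
  have h := ((logHessian_sub_single_posSemidef (c.pt w).1 i).mul_mul_conjTranspose_same
    (jac (fun v => (c.pt v).1) w)ᵀ).smul (Complex.zero_le_real.2 hA)
  rw [← map_star_eq_conjTranspose, Matrix.mul_sub, Matrix.sub_mul, smul_sub, ← ddbar_rho c hw A a,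
    Matrix.mul_smul, Matrix.smul_mul, smul_smul] at h
  push_cast
  exact h

theorem transpose_mul_single_mul_posSemidef {ι κ : Type*} [Fintype ι] [DecidableEq ι] [Fintype κ]
    (J : Matrix ι κ ℂ) (i : ι) (x : ℝ) (hx : 0 ≤ x) :
    ((x : ℂ) • (Jᵀ * Matrix.single i i (1 : ℂ) * J.map star)).PosSemidef := by
  have h : (Matrix.single i i (1 : ℂ)).PosSemidef := by
    rw [← diagonal_single]
    exact PosSemidef.diagonal (Pi.single_nonneg.2 zero_le_one)
  exact (h.mul_mul_conjTranspose_same Jᵀ).smul (Complex.zero_le_real.2 hx)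

theorem ddbar_rho_posSemidef (c : LocalChart f) {w : Fin n → ℂ} (hw : w ∈ c.source)
    {A : ℝ} (hA : 0 ≤ A) (a : ℝ) :
    (ddbar f (fun y => A * (rho y.1 - a)) c w).PosSemidef := by
  have h := (ddbar_rho_sub_posSemidef c hw hA a 0).add
    (transpose_mul_single_mul_posSemidef (jac (fun v => (c.pt v).1) w) 0
      (A * (oneAddNormSq (c.pt w).1 ^ 2)⁻¹) (by positivity))
  rwa [sub_add_cancel] at h

theorem isSmooth_rho (A a : ℝ) : IsSmooth f (fun y => A * (rho y.1 - a)) := by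
  intro c w hw
  have h : ContDiffAt ℝ ∞ (fun v => (c.pt v).1) w :=
    ((c.analyticAt_fst hw).contDiffAt (n := ∞)).restrict_scalars ℝ
  have h1 : ContDiffAt ℝ ∞ (fun v => 1 + ∑ j, ‖(c.pt v).1 j‖ ^ 2) w :=
    contDiffAt_const.add (ContDiffAt.sum fun j _ => (contDiffAt_pi.1 h j).norm_sq ℝ)
  exact (contDiffAt_const.mul ((h1.log (oneAddNormSq_pos (c.pt w).1).ne').sub
    contDiffAt_const)).contDiffWithinAt

end Charts

/-! ### Charts of `Y` in which `t` is one of the coordinates. -/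

section AdaptedChart

variable {n : ℕ} {f : MvPolynomial (Fin (n + 1)) ℂ}

/-- The linear map `(t, v) ↦ (v_1, …, t, …, v_n)` with `t` in place `j`. -/
def replaceCoord (j : Fin n) : ℂ × (Fin n → ℂ) →L[ℂ] (Fin n → ℂ) :=
  ContinuousLinearMap.pi fun k => if k = j then ContinuousLinearMap.fst ℂ ℂ (Fin n → ℂ) else
    (ContinuousLinearMap.proj k).comp (ContinuousLinearMap.snd ℂ ℂ (Fin n → ℂ))

theorem replaceCoord_same (j : Fin n) (p : ℂ × (Fin n → ℂ)) : replaceCoord j p j = p.1 := by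
  simp [replaceCoord]

theorem replaceCoord_of_ne {j k : Fin n} (h : k ≠ j) (p : ℂ × (Fin n → ℂ)) :
    replaceCoord j p k = p.2 k := by
  simp [replaceCoord, h]

/-- The map `(t, v) ↦ (f(l), w)`, where `l` has affine coordinates `v` and `w` is obtained from `v`
by replacing the `j`-th entry with `t`. -/
def straighten (f : MvPolynomial (Fin (n + 1)) ℂ) (i : Fin (n + 1)) (j : Fin n)
    (p : ℂ × (Fin n → ℂ)) : ℂ × (Fin n → ℂ) :=
  (MvPolynomial.eval (homog i p.2) f, replaceCoord j p)

theorem analyticAt_homog_vec (i : Fin (n + 1)) (v : Fin n → ℂ) : AnalyticAt ℂ (homog i) v :=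
  AnalyticAt.pi fun q => analyticAt_homog i q v

theorem analyticAt_straighten (i : Fin (n + 1)) (j : Fin n) (p : ℂ × (Fin n → ℂ)) :
    AnalyticAt ℂ (straighten f i j) p := by
  have h1 : AnalyticAt ℂ (fun p : ℂ × (Fin n → ℂ) => homog i p.2) p :=
    (analyticAt_homog_vec i p.2).fun_comp analyticAt_snd
  exact ((AnalyticOnNhd.eval_mvPolynomial f _ (Set.mem_univ _)).fun_comp h1).prod
    ((replaceCoord j).analyticAt p)

theorem hasFDerivAt_homog (i : Fin (n + 1)) (v : Fin n → ℂ) :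
    HasFDerivAt (homog i) (ContinuousLinearMap.pi (Fin.insertNth i 0 fun k =>
      ContinuousLinearMap.proj k) : (Fin n → ℂ) →L[ℂ] (Fin (n + 1) → ℂ)) v := by
  refine hasFDerivAt_pi.2 fun q => ?_
  cases q using Fin.succAboveCases i with
  | x =>
    simp only [homog_same, Fin.insertNth_apply_same]
    exact hasFDerivAt_const _ _
  | p k =>
    simp only [homog_succAbove, Fin.insertNth_apply_succAbove]
    exact (ContinuousLinearMap.proj (R := ℂ) (φ := fun _ : Fin n => ℂ) k).hasFDerivAt

theorem fderiv_straighten_fst (i : Fin (n + 1)) (j : Fin n) (p u : ℂ × (Fin n → ℂ)) :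
    (fderiv ℂ (straighten f i j) p u).1
      = ∑ k, MvPolynomial.eval (homog i p.2) (MvPolynomial.pderiv (i.succAbove k) f) * u.2 k := by
  have h1 := ((hasFDerivAt_eval f (homog i p.2)).comp p.2 (hasFDerivAt_homog i p.2)).comp p
    (hasFDerivAt_snd (𝕜 := ℂ))
  have h2 := h1.prodMk (replaceCoord j).hasFDerivAt
  have h3 : fderiv ℂ (straighten f i j) p = _ := h2.fderiv
  rw [h3]
  simp [Fin.sum_univ_succAbove _ i]

theorem fderiv_straighten_snd (i : Fin (n + 1)) (j : Fin n) (p u : ℂ × (Fin n → ℂ)) :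
    (fderiv ℂ (straighten f i j) p u).2 = replaceCoord j u := by
  have h1 := (analyticAt_straighten (f := f) i j p).differentiableAt.hasFDerivAt.snd
  have h2 : HasFDerivAt (fun p => (straighten f i j p).2) (replaceCoord j) p :=
    (replaceCoord j).hasFDerivAt
  exact congrArg (fun L => L u) (h1.unique h2)

/-- For a kernel vector, `replaceCoord` kills the `t`-entry and every `v_k` with `k ≠ j`; the
differential of `f` then kills `v_j`. -/
theorem fderiv_straighten_injective (i : Fin (n + 1)) (j : Fin n) (p : ℂ × (Fin n → ℂ))
    (hj : MvPolynomial.eval (homog i p.2) (MvPolynomial.pderiv (i.succAbove j) f) ≠ 0) :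
    Function.Injective (fderiv ℂ (straighten f i j) p) := by
  rw [injective_iff_map_eq_zero]
  intro u hu
  have h2 := (fderiv_straighten_snd (f := f) i j p u).symm.trans (congrArg Prod.snd hu)
  have h1 := (fderiv_straighten_fst (f := f) i j p u).symm.trans (congrArg Prod.fst hu)
  have hne : ∀ k, k ≠ j → u.2 k = 0 := fun k hk => by
    rw [← replaceCoord_of_ne hk, h2]; rfl
  rw [Finset.sum_eq_single j (fun k _ hk => by rw [hne k hk, mul_zero]) (by simp)] at h1
  refine Prod.ext ?_ (funext fun k => ?_)
  · rw [← replaceCoord_same j, h2]; rfl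
  · by_cases hk : k = j
    · subst hk
      exact (mul_eq_zero.1 h1).resolve_left hj
    · exact hne k hk

/-- By the inverse function theorem `straighten` is a local biholomorphism turning `f(l) = 0` into
the vanishing of the first coordinate. The chart is its inverse on that slice, and its `j`-th
coordinate is `t`. -/
theorem exists_adapted_chart {m : ℕ} (hf : f.IsHomogeneous m) (hsing : SmoothAwayFromOrigin f)
    (i : Fin (n + 1)) {q : ℂ × (Fin n → ℂ)} (hq : MvPolynomial.eval (homog i q.2) f = 0) :
    ∃ (c : LocalChart f) (j : Fin n), c.idx = i ∧
      ∀ᶠ p in nhds q, MvPolynomial.eval (homog i p.2) f = 0 →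
        replaceCoord j p ∈ c.source ∧ c.coord (replaceCoord j p) = p := by
  obtain ⟨j, hj⟩ := exists_pderiv_succAbove_ne_zero hf hsing i hq
  have hinj := fderiv_straighten_injective i j q hj
  let L : (ℂ × (Fin n → ℂ)) ≃L[ℂ] (ℂ × (Fin n → ℂ)) :=
    (LinearEquiv.ofInjectiveEndo (fderiv ℂ (straighten f i j) q).toLinearMap
      hinj).toContinuousLinearEquiv
  have hL : (L : (ℂ × (Fin n → ℂ)) →L[ℂ] (ℂ × (Fin n → ℂ))) = fderiv ℂ (straighten f i j) q := by
    ext u <;> rfl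
  have hstrict : HasStrictFDerivAt (straighten f i j)
      (L : (ℂ × (Fin n → ℂ)) →L[ℂ] (ℂ × (Fin n → ℂ))) q :=
    hL ▸ (analyticAt_straighten i j q).hasStrictFDerivAt
  let e := hstrict.toOpenPartialHomeomorph (straighten f i j)
  have he : ∀ p, e p = straighten f i j p := fun p => rfl
  have hqe : q ∈ e.source := hstrict.mem_toOpenPartialHomeomorph_source
  have hsymm : AnalyticAt ℂ e.symm (e q) :=
    e.analyticAt_symm' hqe (analyticAt_straighten i j q) hL.symm
  -- The target is shrunk to the open set where the inverse is analytic, so that the chart is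
  -- holomorphic throughout its source.
  let S : Set (ℂ × (Fin n → ℂ)) := e.target ∩ {x | AnalyticAt ℂ e.symm x}
  have hS : IsOpen S := e.open_target.inter (isOpen_analyticAt ℂ _)
  have hincl : ∀ w : Fin n → ℂ, AnalyticAt ℂ (fun w : Fin n → ℂ => ((0 : ℂ), w)) w := fun w =>
    analyticAt_const.prod analyticAt_id
  have hcont : Continuous fun w : Fin n → ℂ => ((0 : ℂ), w) := by fun_prop
  have hright : ∀ w : Fin n → ℂ, ((0 : ℂ), w) ∈ S →
      straighten f i j (e.symm (0, w)) = (0, w) := fun w hw => e.right_inv hw.1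
  let c : LocalChart f :=
    { idx := i
      source := {w | ((0 : ℂ), w) ∈ S}
      isOpen_source := hS.preimage hcont
      coord := fun w => e.symm (0, w)
      holomorphic := fun w hw => AnalyticAt.fun_comp hw.2 (hincl w)
      injective := by
        intro w hw w' hw' h
        have := (hright w hw).symm.trans ((congrArg (straighten f i j) h).trans (hright w' hw'))
        exact congrArg Prod.snd this
      -- The second component of `straighten` is a holomorphic left inverse of the chart, so
      -- differentiating gives a left inverse of its derivative.
      immersion := by
        intro w hw u u' huu'
        have h1 : AnalyticAt ℂ (fun w : Fin n → ℂ => e.symm ((0 : ℂ), w)) w :=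
          AnalyticAt.fun_comp hw.2 (hincl w)
        have h2 := ((analyticAt_straighten (f := f) i j
          (e.symm (0, w))).differentiableAt.hasFDerivAt.comp w h1.differentiableAt.hasFDerivAt).snd
        have h3 := h2.congr_of_eventuallyEq (f₁ := fun w : Fin n → ℂ => w) (by
          filter_upwards [(hS.preimage hcont).mem_nhds hw] with v hv
          exact (congrArg Prod.snd (hright v hv)).symm)
        have h4 := h3.unique (hasFDerivAt_id (𝕜 := ℂ) w)
        have h5 : ∀ x, (fderiv ℂ (straighten f i j) (e.symm (0, w))
            (fderiv ℂ (fun w : Fin n → ℂ => e.symm ((0 : ℂ), w)) w x)).2 = x :=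
          fun x => congrArg (fun M => M x) h4
        rw [← h5 u, ← h5 u', huu']
      mem := fun w hw => (affinePoint_mem_strictTransform_iff hf i _).2
        (congrArg Prod.fst (hright w hw)) }
  refine ⟨c, j, rfl, ?_⟩
  have hpre : ∀ᶠ p in nhds q, e p ∈ S :=
    (analyticAt_straighten (f := f) i j q).continuousAt.eventually
      (hS.mem_nhds ⟨e.map_source hqe, hsymm⟩)
  filter_upwards [hpre, e.open_source.mem_nhds hqe] with p hp hps h0
  have h1 : e p = (0, replaceCoord j p) := by rw [he, straighten, h0]
  rw [h1] at hp
  exact ⟨hp, by change e.symm (0, replaceCoord j p) = p; rw [← h1, e.left_inv hps]⟩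

end AdaptedChart

/-! ### Comparison of an arbitrary chart with an adapted one. -/

section Transition

variable {n : ℕ} {f : MvPolynomial (Fin (n + 1)) ℂ}

/-- Near the point `z_{i'} = t' = φ_j`, where `i' = c'.idx`. So row `i'` of the Jacobian of `π` is
row `j` of the Jacobian of `φ`, and both rank-one forms are that of `dt'`. -/
theorem exists_transition {m : ℕ} (hf : f.IsHomogeneous m) {c' : LocalChart f} {j : Fin n}
    {p : ℂ × (Fin n → ℂ)}
    (hc' : ∀ᶠ p' in nhds p, MvPolynomial.eval (homog c'.idx p'.2) f = 0 →
      replaceCoord j p' ∈ c'.source ∧ c'.coord (replaceCoord j p') = p')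
    (c : LocalChart f) {w : Fin n → ℂ} (hw : w ∈ c.source) (hp : c.pt w = affinePoint c'.idx p) :
    ∃ φ, IsTransition c c' φ w ∧ φ w = replaceCoord j p ∧
      (jac (fun v => (c.pt v).1) w)ᵀ * Matrix.single c'.idx c'.idx (1 : ℂ)
          * (jac (fun v => (c.pt v).1) w).map star
        = (jacobian φ w)ᵀ * Matrix.single j j (1 : ℂ) * (jacobian φ w).map star := by
  have hne : homog c.idx (c.coord w).2 c'.idx ≠ 0 := homog_ne_zero_of_affinePoint_eq hp
  let τ : (Fin n → ℂ) → ℂ × (Fin n → ℂ) := fun v => affineChange c.idx c'.idx (c.coord v)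
  have hτ : AnalyticAt ℂ τ w :=
    AnalyticAt.fun_comp (analyticAt_affineChange c.idx c'.idx hne) (c.holomorphic w hw)
  have hτw : τ w = p := affinePoint_injective c'.idx ((affinePoint_affineChange hne).trans hp)
  have hτpt : ∀ᶠ v in nhds w, c.pt v = affinePoint c'.idx (τ v) := by
    have hcont : ContinuousAt (fun v => homog c.idx (c.coord v).2 c'.idx) w :=
      ((analyticAt_homog c.idx c'.idx _).fun_comp
        (analyticAt_snd.fun_comp (c.holomorphic w hw))).continuousAt
    filter_upwards [hcont.eventually_ne hne] with v hv
    exact (affinePoint_affineChange hv).symm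
  have hev : ∀ᶠ v in nhds w, replaceCoord j (τ v) ∈ c'.source ∧
      c'.coord (replaceCoord j (τ v)) = τ v := by
    filter_upwards [hτpt, hτ.continuousAt.eventually (hτw.symm ▸ hc'), c.isOpen_source.mem_nhds hw]
      with v hv h hvs
    refine h ((affinePoint_mem_strictTransform_iff hf _ _).1 ?_)
    rw [← hv]
    exact c.mem v hvs
  have hφ : AnalyticAt ℂ (fun v => replaceCoord j (τ v)) w :=
    ((replaceCoord j).analyticAt _).fun_comp hτ
  refine ⟨fun v => replaceCoord j (τ v), ⟨hw, hev.self_of_nhds.1, hφ.differentiableAt, ?_⟩, ?_, ?_⟩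
  · filter_upwards [hτpt, hev] with v hv h
    rw [hv, LocalChart.pt, h.2]
  · simp only [hτw]
  · have hrow : ∀ k, jac (fun v => (c.pt v).1) w c'.idx k
        = jacobian (fun v => replaceCoord j (τ v)) w j k := by
      intro k
      have h1 := hasFDerivAt_apply (c.analyticAt_fst hw).differentiableAt c'.idx
      have h2 := hasFDerivAt_apply hφ.differentiableAt j
      have h3 : (fun v => (c.pt v).1 c'.idx) =ᶠ[nhds w] fun v => replaceCoord j (τ v) j := by
        filter_upwards [hτpt] with v hv
        rw [hv, replaceCoord_same]
        simp [affinePoint, homog_same]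
      exact congrArg (fun M => M (Pi.single k 1)) (h1.unique (h2.congr_of_eventuallyEq h3))
    have hentry : ∀ {ι : Type} [Fintype ι] [DecidableEq ι] (M : Matrix ι (Fin n) ℂ) (i : ι) (a b),
        (Mᵀ * Matrix.single i i (1 : ℂ) * M.map star) a b = M i a * star (M i b) := by
      intro ι _ _ M i a b
      rw [Matrix.mul_assoc, Matrix.mul_apply, Finset.sum_eq_single i]
      · simp
      · intro k _ hk
        simp [hk]
      · simp
    ext a b
    rw [hentry, hentry, hrow, hrow]

theorem IsTransition.t_eq {c c' : LocalChart f} {φ : (Fin n → ℂ) → (Fin n → ℂ)} {w : Fin n → ℂ}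
    (h : IsTransition c c' φ w) : c'.t (φ w) = c.t w * c.l w c'.idx := by
  have h2 := congrFun (congrArg Prod.fst h.pt_eq.self_of_nhds) c'.idx
  simp only [LocalChart.pt, affinePoint, Pi.smul_apply, smul_eq_mul, homog_same] at h2
  simp only [LocalChart.t, LocalChart.l, h2, mul_one]

theorem HermitianMetric.normSq_eq {k : ℕ} (h : HermitianMetric f k) {c c' : LocalChart f}
    {φ : (Fin n → ℂ) → (Fin n → ℂ)} {w : Fin n → ℂ} (hφ : IsTransition c c' φ w) :
    h.normSq c w = h.normSq c' (φ w) := by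
  rw [normSq, normSq, hφ.t_eq, h.transform c c' w hφ.mem_source (φ w) hφ.map_mem_source
    hφ.pt_eq.self_of_nhds, norm_mul, mul_pow]
  ring

theorem rhs_transform {V : Set (Fin (n + 1) → ℂ)} {d : ℤ} (ν : CanonicalGenerator f V d)
    (hE : HermitianMetric f d.toNat) (hF : HermitianMetric f (-d).toNat) (s : ℝ)
    {c c' : LocalChart f} {φ : (Fin n → ℂ) → (Fin n → ℂ)} {w : Fin n → ℂ}
    (hφ : IsTransition c c' φ w) (hV : (c.pt w).1 ∈ V) :
    rhs ν hE hF s c w = ‖(jacobian φ w).det‖ ^ 2 * rhs ν hE hF s c' (φ w) := by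
  have hpt := hφ.pt_eq.self_of_nhds
  have hne : ‖c.l w c'.idx‖ ≠ 0 := norm_ne_zero_iff.2 (homog_ne_zero_of_affinePoint_eq hpt)
  -- The transition factors of `h_E`, `h_F` and `ν` cancel because `d = max(d,0) - max(-d,0)`.
  have key : (‖c.l w c'.idx‖ ^ (2 * d.toNat))⁻¹ * ‖c.l w c'.idx‖ ^ (2 * (-d).toNat)
      * (‖c.l w c'.idx‖ ^ d) ^ 2 = 1 := by
    rw [← zpow_natCast, ← zpow_natCast, ← zpow_natCast, ← _root_.zpow_neg, ← _root_.zpow_mul,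
      ← zpow_add₀ hne, ← zpow_add₀ hne]
    have : -((2 * d.toNat : ℕ) : ℤ) + ((2 * (-d).toNat : ℕ) : ℤ) + d * ((2 : ℕ) : ℤ) = 0 := by
      omega
    rw [this, zpow_zero]
  rw [rhs, rhs, hE.normSq_eq hφ, hF.normSq_eq hφ, CanonicalGenerator.volY, CanonicalGenerator.volY,
    hE.transform c c' w hφ.mem_source (φ w) hφ.map_mem_source hpt,
    hF.transform c c' w hφ.mem_source (φ w) hφ.map_mem_source hpt, ν.transform c c' φ w hφ hV]
  simp only [norm_mul, norm_zpow, mul_pow, mul_inv]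
  linear_combination ((hE.normSq c' (φ w) + s) * (hF.normSq c' (φ w) + s)⁻¹ *
    (hE.weight c' (φ w))⁻¹ * hF.weight c' (φ w) * ‖ν.g c' (φ w)‖ ^ 2
    * ‖(jacobian φ w).det‖ ^ 2) * key

theorem continuousAt_rhs {V : Set (Fin (n + 1) → ℂ)} {d : ℤ} (ν : CanonicalGenerator f V d)
    (hE : HermitianMetric f d.toNat) (hF : HermitianMetric f (-d).toNat) {s : ℝ} (hs : 0 < s)
    {c : LocalChart f} {w : Fin n → ℂ} (hw : w ∈ c.source) (hV : (c.pt w).1 ∈ V) :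
    ContinuousAt (rhs ν hE hF s c) w := by
  have hsrc := c.isOpen_source.mem_nhds hw
  have ht : ContinuousAt (fun w => ‖c.t w‖) w :=
    (continuous_fst.continuousAt.comp (c.holomorphic w hw).continuousAt).norm
  have hwt : ∀ {k : ℕ} (h : HermitianMetric f k), ContinuousAt (h.weight c) w := fun h =>
    (h.smooth c).continuousOn.continuousAt hsrc
  have hn : ∀ {k : ℕ} (h : HermitianMetric f k), ContinuousAt (h.normSq c) w := fun h =>
    (ht.pow _).mul (hwt h)
  -- The perturbation `s > 0` keeps the denominator positive even where `σ_F` vanishes.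
  have hF0 : hF.normSq c w + s ≠ 0 :=
    (add_pos_of_nonneg_of_pos (mul_nonneg (by positivity) (hF.pos c w hw).le) hs).ne'
  have hg : ContinuousAt (ν.g c) w := (ν.holomorphic c w ⟨hw, hV⟩).continuousAt
  exact (((hn hE).add continuousAt_const).mul (((hn hF).add continuousAt_const).inv₀ hF0)).mul
    ((((hwt hE).inv₀ (hE.pos c w hw).ne').mul (hwt hF)).mul (hg.norm.pow 2))

end Transition

/-! ### The Monge–Ampère inequality near a point. -/

section LocalEstimate

variable {n : ℕ} {f : MvPolynomial (Fin (n + 1)) ℂ}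

theorem topPower_ge {P Q : Matrix (Fin n) (Fin n) ℂ} (hP : P.PosDef) (hQ : Q.PosSemidef) :
    P.det.re ≤ topPower (P + Q) := by
  have h1 := det_re_le_det_add_re hP hQ
  have h2 : 0 < P.det.re := (Complex.pos_iff.1 hP.det_pos).1
  have h3 : (1 : ℝ) ≤ n.factorial := by exact_mod_cast n.factorial_pos
  rw [topPower]
  nlinarith

theorem oneAddNormSq_lt_exp {a : ℝ} {z : Fin (n + 1) → ℂ} (hz : rho z < a) :
    oneAddNormSq z < Real.exp a :=
  (Real.log_lt_iff_lt_exp (oneAddNormSq_pos z)).1 hz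

/-- In a chart `c` with a transition to `c'`, the Monge–Ampère measure is bounded below by the
pull-back of `det (s θ + x e_j e_jᵀ)`. -/
theorem le_topPower_of_transition {θ : Form11 f} (hθ : θ.IsKahler) {s : ℝ} (hs : 0 < s)
    {c c' : LocalChart f} {φ : (Fin n → ℂ) → (Fin n → ℂ)} {w : Fin n → ℂ}
    (hφ : IsTransition c c' φ w) {j : Fin n}
    (hrow : (jac (fun v => (c.pt v).1) w)ᵀ * Matrix.single c'.idx c'.idx (1 : ℂ)
          * (jac (fun v => (c.pt v).1) w).map star
        = (jacobian φ w)ᵀ * Matrix.single j j (1 : ℂ) * (jacobian φ w).map star)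
    {W : Matrix (Fin n) (Fin n) ℂ} (hW : W.PosSemidef) {A a : ℝ} (hA : 0 ≤ A) :
    ‖(jacobian φ w).det‖ ^ 2 * ((A * (oneAddNormSq (c.pt w).1 ^ 2)⁻¹)
        * (((s : ℂ) • θ.coeff c' (φ w)).adjugate j j).re)
      ≤ topPower (W + (s : ℂ) • θ.coeff c w + ddbar f (fun y => A * (rho y.1 - a)) c w) := by
  set x := A * (oneAddNormSq (c.pt w).1 ^ 2)⁻¹ with hx
  have hx0 : 0 ≤ x := by positivity
  set J := jacobian φ w with hJ
  have hs' : (0 : ℂ) < (s : ℂ) := Complex.zero_lt_real.2 hs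
  have hθc := (hθ.posDef c w hφ.mem_source).smul hs'
  have hθc' := (hθ.posDef c' (φ w) hφ.map_mem_source).smul hs'
  have hsub := ddbar_rho_sub_posSemidef c hφ.mem_source hA a c'.idx
  rw [hrow, ← hx] at hsub
  have hP : ((s : ℂ) • θ.coeff c w
      + (x : ℂ) • (Jᵀ * Matrix.single j j (1 : ℂ) * J.map star)).PosDef :=
    -- Only `sθ` and the rank-one part of `A √-1 ∂∂̄ρ` are kept; the remainder and `W` are
    -- semipositive and cannot lower the determinant.
    hθc.add_posSemidef (transpose_mul_single_mul_posSemidef J j x hx0)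
  have hle := topPower_ge hP (hW.add hsub)
  have e1 : (s : ℂ) • θ.coeff c w + (x : ℂ) • (Jᵀ * Matrix.single j j (1 : ℂ) * J.map star)
      + (W + (ddbar f (fun y => A * (rho y.1 - a)) c w
        - (x : ℂ) • (Jᵀ * Matrix.single j j (1 : ℂ) * J.map star)))
      = W + (s : ℂ) • θ.coeff c w + ddbar f (fun y => A * (rho y.1 - a)) c w := by abel
  have e2 : (s : ℂ) • θ.coeff c w + (x : ℂ) • (Jᵀ * Matrix.single j j (1 : ℂ) * J.map star)
      = Jᵀ * ((s : ℂ) • θ.coeff c' (φ w) + (x : ℂ) • Matrix.single j j (1 : ℂ)) * J.map star := by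
    rw [θ.transform c c' φ w hφ, Matrix.mul_add, Matrix.add_mul]
    simp only [Matrix.mul_smul, Matrix.smul_mul, hJ]
  rw [e1, e2, det_transpose_mul_mul_map_star, det_add_smul_single, Complex.add_re,
    Complex.re_ofReal_mul] at hle
  refine le_trans ?_ hle
  have := (Complex.pos_iff.1 hθc'.det_pos).1
  gcongr
  linarith

/-- The adapted chart serves only for the estimate: both sides scale by `|det J|²`, so the bound
passes to every chart `c` with the same `A₁`. Leaving `W` arbitrary makes `A₁` independent of `ω`.
-/
theorem exists_local_bound {m : ℕ} (hf : f.IsHomogeneous m) (hsing : SmoothAwayFromOrigin f)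
    (a : ℝ) {θ : Form11 f} (hθ : θ.IsKahler) {V : Set (Fin (n + 1) → ℂ)}
    (hUV : closure (domain f a) ⊆ V) {d : ℤ} (ν : CanonicalGenerator f V d)
    (hE : HermitianMetric f d.toNat) (hF : HermitianMetric f (-d).toNat) {s : ℝ} (hs : 0 < s)
    (i : Fin (n + 1)) {q : ℂ × (Fin n → ℂ)} (hq : MvPolynomial.eval (homog i q.2) f = 0)
    (hqV : (affinePoint i q).1 ∈ V) :
    ∃ A₁ : ℝ, ∀ᶠ p in nhds q, ∀ (c : LocalChart f), ∀ w ∈ c.source, c.pt w = affinePoint i p →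
      (c.pt w).1 ∈ domain f a → ∀ W : Matrix (Fin n) (Fin n) ℂ, W.PosSemidef →
      ∀ A, A₁ ≤ A → 0 ≤ A → rhs ν hE hF s c w ≤
        topPower (W + (s : ℂ) • θ.coeff c w + ddbar f (fun y => A * (rho y.1 - a)) c w) := by
  obtain ⟨c', j, rfl, hc'⟩ := exists_adapted_chart hf hsing i hq
  obtain ⟨hw', hcoord⟩ := hc'.self_of_nhds hq
  set w' := replaceCoord j q with hw'def
  have hw'V : (c'.pt w').1 ∈ V := by rw [LocalChart.pt, hcoord]; exact hqV
  have hRc := continuousAt_rhs ν hE hF hs hw' hw'V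
  set R := rhs ν hE hF s c' with hR
  let h : (Fin n → ℂ) → ℝ := fun v => (((s : ℂ) • θ.coeff c' v).adjugate j j).re
  have hh0 : 0 < h w' := adjugate_diag_re_pos
    ((hθ.posDef c' w' hw').smul (Complex.zero_lt_real.2 hs)) j
  have hhc : ContinuousAt h w' := by
    have h1 : ContinuousAt (fun v => (s : ℂ) • θ.coeff c' v) w' :=
      (continuousAt_pi.2 fun a => continuousAt_pi.2 fun b =>
        (θ.smooth c' a b).continuousOn.continuousAt
          (c'.isOpen_source.mem_nhds hw')).const_smul (s : ℂ)
    have h2 : Continuous fun M : Matrix (Fin n) (Fin n) ℂ => (M.adjugate j j).re :=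
      Complex.continuous_re.comp (continuous_id.matrix_adjugate.matrix_elem j j)
    exact h2.continuousAt.comp h1
  -- The added `1` makes `C` positive and `R < C h` strict at `w'`, so by continuity the inequality
  -- persists nearby.
  set C := (|R w'| + 1) / h w' with hC
  have hC0 : 0 < C := by positivity
  have hlt : R w' < C * h w' := by
    rw [hC, div_mul_cancel₀ _ hh0.ne']
    linarith [le_abs_self (R w')]
  have hev : ∀ᶠ v in nhds w', R v < C * h v ∧ 0 < h v :=
    (hRc.eventually_lt (continuousAt_const.mul hhc) hlt).and
      (continuousAt_const.eventually_lt hhc hh0)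
  -- On the domain `S < e^a`, so `A ≥ C e^{2a}` ensures `A S⁻² ≥ C`.
  refine ⟨C * Real.exp a ^ 2, ?_⟩
  filter_upwards [(replaceCoord j).continuous.continuousAt.eventually hev,
    hc'.eventually_nhds] with p hp hpc c w hw hpt hdom W hW A hAC hA
  obtain ⟨φ, hφ, hφw, hrow⟩ := exists_transition hf hpc c hw hpt
  have hle := le_topPower_of_transition hθ hs hφ hrow hW (a := a) hA
  refine le_trans ?_ hle
  rw [rhs_transform ν hE hF s hφ (hUV (subset_closure hdom)), ← hR, hφw]
  have hCx : C ≤ A * (oneAddNormSq (c.pt w).1 ^ 2)⁻¹ := by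
    have h1 := oneAddNormSq_pos (c.pt w).1
    have h2 := oneAddNormSq_lt_exp hdom.2
    rw [← div_eq_mul_inv, le_div_iff₀ (by positivity)]
    refine le_trans ?_ hAC
    gcongr
  gcongr
  exact hp.1.le.trans (mul_le_mul_of_nonneg_right hCx hp.2.le)

end LocalEstimate

/-! ### From local bounds to a uniform bound. -/

section Compactness

variable {n : ℕ} {f : MvPolynomial (Fin (n + 1)) ℂ}

/-- The points of the closure of `π⁻¹(U)` in the affine piece `{l_i ≠ 0}` whose affine coordinates
`l_j / l_i` have modulus at most one. -/
def affineCompact (f : MvPolynomial (Fin (n + 1)) ℂ) (a : ℝ) (i : Fin (n + 1)) :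
    Set (ℂ × (Fin n → ℂ)) :=
  {p | MvPolynomial.eval (homog i p.2) f = 0 ∧ (affinePoint i p).1 ∈ closure (domain f a) ∧
    ∀ k, ‖p.2 k‖ ≤ 1}

theorem continuous_homog (i : Fin (n + 1)) : Continuous (homog (n := n) i) :=
  continuous_iff_continuousAt.2 fun v => (analyticAt_homog_vec i v).continuousAt

theorem continuous_rho : Continuous (rho (n := n)) :=
  Continuous.log (by fun_prop) fun z => (oneAddNormSq_pos z).ne'

theorem isClosed_sublevel (f : MvPolynomial (Fin (n + 1)) ℂ) (a : ℝ) :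
    IsClosed {z | MvPolynomial.eval z f = 0 ∧ rho z ≤ a} :=
  (isClosed_eq (MvPolynomial.continuous_eval f) continuous_const).inter
    (isClosed_le continuous_rho continuous_const)

theorem closure_domain_subset (f : MvPolynomial (Fin (n + 1)) ℂ) (a : ℝ) :
    closure (domain f a) ⊆ {z | MvPolynomial.eval z f = 0 ∧ rho z ≤ a} :=
  closure_minimal (fun _ hz => ⟨hz.1, hz.2.le⟩) (isClosed_sublevel f a)

theorem isCompact_affineCompact (f : MvPolynomial (Fin (n + 1)) ℂ) (a : ℝ) (i : Fin (n + 1)) :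
    IsCompact (affineCompact f a i) := by
  have hcont : Continuous fun p : ℂ × (Fin n → ℂ) => homog i p.2 :=
    (continuous_homog i).comp continuous_snd
  have hclosed : IsClosed (affineCompact f a i) := by
    refine (isClosed_eq ((MvPolynomial.continuous_eval f).comp hcont) continuous_const).inter
      ((isClosed_closure.preimage (continuous_fst.smul hcont)).inter ?_)
    change IsClosed {p : ℂ × (Fin n → ℂ) | ∀ k, ‖p.2 k‖ ≤ 1}
    rw [Set.ofPred_forall]
    exact isClosed_iInter fun k => isClosed_le (by fun_prop) continuous_const
  refine Metric.isCompact_of_isClosed_isBounded hclosed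
    ((Metric.isBounded_closedBall (x := 0) (r := max (Real.exp a) 1)).subset fun p hp => ?_)
  rw [mem_closedBall_zero_iff, Prod.norm_def]
  refine max_le_max ?_ ((pi_norm_le_iff_of_nonneg zero_le_one).2 hp.2.2)
  have h1 := (closure_domain_subset f a hp.2.1).2
  have h2 := (Real.log_le_iff_le_exp (oneAddNormSq_pos _)).1 h1
  have h3 : ‖p.1‖ ^ 2 ≤ ∑ q, ‖(affinePoint i p).1 q‖ ^ 2 := by
    have := Finset.single_le_sum (f := fun q => ‖(affinePoint i p).1 q‖ ^ 2)
      (fun q _ => sq_nonneg _) (Finset.mem_univ i)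
    simpa [affinePoint, homog_same] using this
  rw [oneAddNormSq] at h2
  -- Uses `2|t| ≤ 1 + |t|² ≤ S ≤ e^a`.
  nlinarith [norm_nonneg p.1, sq_nonneg (‖p.1‖ - 1)]

/-- Normalize by an entry of `l` of largest modulus. Hence the compact pieces cover the closure of
`π⁻¹(U)`. -/
theorem exists_affinePoint_norm_le (i : Fin (n + 1)) (p : ℂ × (Fin n → ℂ)) :
    ∃ (i' : Fin (n + 1)) (p' : ℂ × (Fin n → ℂ)), affinePoint i p = affinePoint i' p' ∧
      ∀ k, ‖p'.2 k‖ ≤ 1 := by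
  obtain ⟨i', -, hi'⟩ := Finset.exists_max_image Finset.univ (fun q => ‖homog i p.2 q‖)
    Finset.univ_nonempty
  have h1 : 1 ≤ ‖homog i p.2 i'‖ := by
    simpa [homog_same] using hi' i (Finset.mem_univ i)
  have h0 : homog i p.2 i' ≠ 0 := norm_pos_iff.1 (zero_lt_one.trans_le h1)
  refine ⟨i', affineChange i i' p, (affinePoint_affineChange h0).symm, fun k => ?_⟩
  rw [affineChange, norm_div]
  exact div_le_one_of_le₀ (hi' _ (Finset.mem_univ _)) (norm_nonneg _)

theorem exists_uniform_bound {m : ℕ} (hf : f.IsHomogeneous m) (hsing : SmoothAwayFromOrigin f)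
    (a : ℝ) {θ : Form11 f} (hθ : θ.IsKahler) {V : Set (Fin (n + 1) → ℂ)}
    (hUV : closure (domain f a) ⊆ V) {d : ℤ} (ν : CanonicalGenerator f V d)
    (hE : HermitianMetric f d.toNat) (hF : HermitianMetric f (-d).toNat) {s : ℝ} (hs : 0 < s) :
    ∃ A₁ : ℝ, ∀ (c : LocalChart f), ∀ w ∈ c.source,
      (c.pt w).1 ∈ domain f a → ∀ W : Matrix (Fin n) (Fin n) ℂ, W.PosSemidef →
      ∀ A, A₁ ≤ A → 0 ≤ A → rhs ν hE hF s c w ≤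
        topPower (W + (s : ℂ) • θ.coeff c w + ddbar f (fun y => A * (rho y.1 - a)) c w) := by
  have key : ∀ i, ∃ A₁ : ℝ, ∀ p ∈ affineCompact f a i, ∀ (c : LocalChart f), ∀ w ∈ c.source,
      c.pt w = affinePoint i p →
      (c.pt w).1 ∈ domain f a → ∀ W : Matrix (Fin n) (Fin n) ℂ, W.PosSemidef →
      ∀ A, A₁ ≤ A → 0 ≤ A → rhs ν hE hF s c w ≤
        topPower (W + (s : ℂ) • θ.coeff c w + ddbar f (fun y => A * (rho y.1 - a)) c w) := by
    intro i
    refine (isCompact_affineCompact f a i).induction_on ⟨0, fun p hp => hp.elim⟩ ?_ ?_ ?_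
    · rintro S T hST ⟨A₁, h⟩
      exact ⟨A₁, fun p hp => h p (hST hp)⟩
    · rintro S T ⟨A₁, h⟩ ⟨A₂, h'⟩
      refine ⟨max A₁ A₂, fun p hp c w hw hpt hdom W hW A hA => ?_⟩
      rcases hp with hp | hp
      · exact h p hp c w hw hpt hdom W hW A ((le_max_left _ _).trans hA)
      · exact h' p hp c w hw hpt hdom W hW A ((le_max_right _ _).trans hA)
    · intro q hq
      obtain ⟨A₁, h⟩ := exists_local_bound hf hsing a hθ hUV ν hE hF hs i hq.1 (hUV hq.2.1)
      exact ⟨_, mem_nhdsWithin_of_mem_nhds h, A₁, fun p hp => hp⟩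
  choose B hB using key
  -- A convenient common upper bound for the finitely many thresholds.
  refine ⟨∑ i, |B i|, fun c w hw hdom W hW A hA => ?_⟩
  obtain ⟨i, p, hp, hp1⟩ := exists_affinePoint_norm_le c.idx (c.coord w)
  have hp' : c.pt w = affinePoint i p := hp
  refine hB i p ⟨(affinePoint_mem_strictTransform_iff hf i p).1 (hp' ▸ c.mem w hw),
    hp' ▸ subset_closure hdom, hp1⟩ c w hw hp' hdom W hW A (le_trans ?_ hA)
  exact (le_abs_self _).trans (Finset.single_le_sum (f := fun i => |B i|)
    (fun i _ => abs_nonneg _) (Finset.mem_univ i))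

end Compactness

end BlowupMA

end

open BlowupMA in
theorem mainTheorem6 {n m : ℕ} (hn : 1 ≤ n) (hm : 1 ≤ m)
    (f : MvPolynomial (Fin (n + 1)) ℂ) (hf : f.IsHomogeneous m) (hsing : SmoothAwayFromOrigin f)
    (a : ℝ) (ha : 0 < a)
    (θ : Form11 f) (hθ : θ.IsKahler)
    (V : Set (Fin (n + 1) → ℂ)) (hV : IsOpen V) (hUV : closure (domain f a) ⊆ V)
    (d : ℤ) (ν : CanonicalGenerator f V d)
    (hE : HermitianMetric f d.toNat) (hF : HermitianMetric f (-d).toNat)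
    (ψ₁ : (Fin (n + 1) → ℂ) × Projectivization ℂ (Fin (n + 1) → ℂ) → ℝ)
    (hψ₁ : IsSmooth f ψ₁)
    (hψ₁_zero : ∃ r > 0, ∀ y ∈ strictTransform f, ‖y.1‖ < r → ψ₁ y = 0)
    (A₀ : ℝ)
    (hω : ∀ c : LocalChart f, ∀ w ∈ c.source, (c.pt w).1 ∈ domain f a →
      (omega f a A₀ ψ₁ c w).PosSemidef)
    (s : ℝ) (hs : 0 < s) :
    ∃ A₁ : ℝ, ∀ A ≥ A₁,
      IsSubsolution f a (omega f a A₀ ψ₁) θ.coeff s (rhs ν hE hF s)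
        (fun y => A * (rho y.1 - a)) := by
  obtain ⟨A₁, hA₁⟩ := exists_uniform_bound hf hsing a hθ hUV ν hE hF hs
  -- Nonnegativity of `A` is needed for `A √-1 ∂∂̄ρ` to be semipositive.
  refine ⟨max A₁ 0, fun A hA => ?_⟩
  have hA0 : 0 ≤ A := (le_max_right _ _).trans hA
  refine ⟨isSmooth_rho A a, fun y _ hy => ?_, fun c w hw hdom => ?_, fun c w hw hdom => ?_⟩
  -- Closure points satisfy `f = 0` and `ρ ≤ a`; outside the domain this leaves only `ρ = a`.
  · have h1 := closure_domain_subset f a hy.1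
    have h2 : rho y.1 = a := le_antisymm h1.2 (not_lt.1 fun h => hy.2 ⟨h1.1, h⟩)
    rw [h2, sub_self, mul_zero]
  · exact (((hθ.posDef c w hw).smul (Complex.zero_lt_real.2 hs)).posSemidef_add
      (hω c w hw hdom)).add_posSemidef (ddbar_rho_posSemidef c hw hA0 a)
  · exact hA₁ c w hw hdom _ (hω c w hw hdom) A ((le_max_left _ _).trans hA) hA0
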